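/- Let $k$ be an algebraically closed field of characteristic $0$ and let $Q$ be an extended Dynkin quiver, i.e. a quiver whose underlying graph is of type $\widetilde{A_{n-1}}$ ($n\ge 2$ vertices, a cycle of length $n$; for $n=2$ two vertices joined by two edges), $\widetilde{D_{n-1}}$ ($n\ge 5$ vertices) or $\widetilde{E_m}$ ($m=6,7,8$). Let $\bar Q$ be its double, obtained by adding to each arrow $\alpha$ of $Q$ an arrow $\alpha^\ast$ in the opposite direction, and let $$A=\Pi(Q)=k\bar Q\Big/\Big(\sum_{\alpha\in Q_1}(\alpha\alpha^\ast-\alpha^\ast\alpha)\Big)$$ be the preprojective algebra, graded by path length, with the idempotents $e_i$ given by the trivial paths at the vertices $i$. Let $g$ be a graded $k$-algebra automorphism of $A$ that fixes every $e_i$ and scales the arrows: for every arrow $\alpha$ of $Q$ there are nonzero scalars $c_\alpha,t_\alpha\in k$ with $g(\alpha)=c_\alpha\alpha$ and $g(\alpha^\ast)=t_\alpha\alpha^\ast$. For a graded automorphism $\varphi$ of a locally finite $\mathbb N$-graded vector space $M=\bigoplus_{s\ge 0}M_s$ put $\operatorname{Tr}_M(\varphi,t)=\sum_{s\ge 0}\operatorname{tr}_k(\varphi|_{M_s})\,t^s$.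 Then for every vertex $i$ the series $\operatorname{Tr}_{e_iA}(g|_{e_iA},t)$ and $\operatorname{Tr}_{Ae_i}((g|_{Ae_i})^{-1},t)$ are the expansions at $t=0$ of rational functions in $k(t)$, and for every arrow $\alpha$ of $Q$ $$\operatorname{Tr}_{Ae_i}\big((g|_{Ae_i})^{-1},t^{-1}\big)=c_\alpha t_\alpha\,t^2\,\operatorname{Tr}_{e_iA}\big(g|_{e_iA},t\big)$$ as rational functions in $k(t)$. (In particular this holds with $c_\alpha t_\alpha=c_1t_1$ for the arrow $\alpha_1$.) -/

import Mathlib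

noncomputable section

namespace Preproj

/-! ### Path algebras -/

/-- All paths of a quiver, each with its source and its target. The trivial path at `a` is
`⟨a, a, Quiver.Path.nil⟩`. -/
abbrev AnyPath (V : Type*) [Quiver V] := Σ a b : V, Quiver.Path a b

/-- The path algebra: the vector space with basis the set of all paths. -/
def PathAlgebra (k V : Type*) [Field k] [Quiver V] := AnyPath V →₀ k

namespace PathAlgebra

variable (k : Type*) {V : Type*} [Field k] [Quiver V]

instance : AddCommGroup (PathAlgebra k V) := inferInstanceAs (AddCommGroup (AnyPath V →₀ k))

instance : Module k (PathAlgebra k V) := inferInstanceAs (Module k (AnyPath V →₀ k))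

/-- The basis element attached to a path. -/
def ofPath (p : AnyPath V) : PathAlgebra k V := Finsupp.single p 1

open Classical in
/-- The product of two paths: first `p`, then `q`; it is the concatenation if `p` ends where `q`
starts, and `0` otherwise. -/
def pathMul (p q : AnyPath V) : PathAlgebra k V :=
  if h : p.2.1 = q.1 then ofPath k ⟨p.1, q.2.1, p.2.2.comp (q.2.2.cast h.symm rfl)⟩ else 0

/-- The bilinear extension of the product of paths. -/
def mulHom : PathAlgebra k V →ₗ[k] PathAlgebra k V →ₗ[k] PathAlgebra k V :=
  Finsupp.linearCombination k fun p : AnyPath V =>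
    (Finsupp.linearCombination k fun q : AnyPath V => pathMul k p q :
      PathAlgebra k V →ₗ[k] PathAlgebra k V)

instance : Mul (PathAlgebra k V) := ⟨fun x y => mulHom k x y⟩

/-- The unit is the sum of all trivial paths. -/
instance [Fintype V] : One (PathAlgebra k V) :=
  ⟨∑ a : V, ofPath k ⟨a, a, Quiver.Path.nil⟩⟩

variable {k}

theorem mul_def (x y : PathAlgebra k V) : x * y = mulHom k x y := rfl

theorem one_def [Fintype V] :
    (1 : PathAlgebra k V) = ∑ a : V, ofPath k ⟨a, a, Quiver.Path.nil⟩ := rfl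

theorem ofPath_mul_ofPath (p q : AnyPath V) : ofPath k p * ofPath k q = pathMul k p q := by
  rw [mul_def, mulHom, ofPath, ofPath]
  erw [Finsupp.linearCombination_single, one_smul, Finsupp.linearCombination_single, one_smul]

theorem pathMul_comp {a b c : V} (p : Quiver.Path a b) (q : Quiver.Path b c) :
    pathMul k ⟨a, b, p⟩ ⟨b, c, q⟩ = ofPath k ⟨a, c, p.comp q⟩ := by
  simp [pathMul]

theorem pathMul_of_ne {p q : AnyPath V} (h : p.2.1 ≠ q.1) : pathMul k p q = 0 := by
  simp [pathMul, h]

protected theorem induction {P : PathAlgebra k V → Prop} (x : PathAlgebra k V) (h0 : P 0)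
    (hadd : ∀ x y, P x → P y → P (x + y))
    (hpath : ∀ (r : k) (p : AnyPath V), P (r • ofPath k p)) : P x := by
  refine Finsupp.induction_linear (motive := fun y : AnyPath V →₀ k => P y) x h0 hadd ?_
  intro p r
  have := hpath r p
  rw [ofPath] at this
  erw [Finsupp.smul_single, smul_eq_mul, mul_one] at this
  exact this

protected theorem add_mul (x y z : PathAlgebra k V) : (x + y) * z = x * z + y * z := by
  simp [mul_def]

protected theorem mul_add (x y z : PathAlgebra k V) : x * (y + z) = x * y + x * z := by
  simp [mul_def]

protected theorem smul_mul (r : k) (x y : PathAlgebra k V) : (r • x) * y = r • (x * y) := by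
  simp [mul_def]

protected theorem mul_smul (r : k) (x y : PathAlgebra k V) : x * (r • y) = r • (x * y) := by
  simp [mul_def]

protected theorem zero_mul (x : PathAlgebra k V) : 0 * x = 0 := by simp [mul_def]

protected theorem mul_zero (x : PathAlgebra k V) : x * 0 = 0 := by simp [mul_def]

theorem ofPath_mul_assoc (p q r : AnyPath V) :
    ofPath k p * ofPath k q * ofPath k r = ofPath k p * (ofPath k q * ofPath k r) := by
  obtain ⟨a, b, p⟩ := p
  obtain ⟨b', c, q⟩ := q
  obtain ⟨c', d, r⟩ := r
  simp only [ofPath_mul_ofPath]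
  by_cases h : b = b'
  · subst h
    by_cases h' : c = c'
    · subst h'
      simp only [pathMul_comp, ofPath_mul_ofPath, Quiver.Path.comp_assoc]
    · rw [pathMul_comp, ofPath_mul_ofPath, pathMul_of_ne h', pathMul_of_ne h',
        PathAlgebra.mul_zero]
  · rw [pathMul_of_ne h, PathAlgebra.zero_mul]
    by_cases h' : c = c'
    · subst h'
      rw [pathMul_comp, ofPath_mul_ofPath, pathMul_of_ne h]
    · rw [pathMul_of_ne h', PathAlgebra.mul_zero]

protected theorem mul_assoc (x y z : PathAlgebra k V) : x * y * z = x * (y * z) := by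
  induction x using PathAlgebra.induction with
  | h0 => simp only [PathAlgebra.zero_mul]
  | hadd x x' hx hx' => simp only [PathAlgebra.add_mul, hx, hx']
  | hpath r p =>
    induction y using PathAlgebra.induction with
    | h0 => simp only [PathAlgebra.zero_mul, PathAlgebra.mul_zero]
    | hadd y y' hy hy' => simp only [PathAlgebra.add_mul, PathAlgebra.mul_add, hy, hy']
    | hpath s q =>
      induction z using PathAlgebra.induction with
      | h0 => simp only [PathAlgebra.mul_zero]
      | hadd z z' hz hz' => simp only [PathAlgebra.mul_add, hz, hz']
      | hpath t w =>
        simp only [PathAlgebra.smul_mul, PathAlgebra.mul_smul, ofPath_mul_assoc]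

theorem sum_mul_ofPath [Fintype V] (p : AnyPath V) : (1 : PathAlgebra k V) * ofPath k p =
    ofPath k p := by
  obtain ⟨a, b, p⟩ := p
  rw [one_def, mul_def, map_sum, LinearMap.sum_apply]
  simp only [← mul_def, ofPath_mul_ofPath]
  rw [Finset.sum_eq_single a (fun c _ hc => pathMul_of_ne hc) (by simp), pathMul_comp,
    Quiver.Path.nil_comp]

theorem ofPath_mul_sum [Fintype V] (p : AnyPath V) : ofPath k p * (1 : PathAlgebra k V) =
    ofPath k p := by
  obtain ⟨a, b, p⟩ := p
  rw [one_def, mul_def, map_sum]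
  simp only [← mul_def, ofPath_mul_ofPath]
  rw [Finset.sum_eq_single b (fun c _ hc => pathMul_of_ne (Ne.symm hc)) (by simp), pathMul_comp,
    Quiver.Path.comp_nil]

protected theorem one_mul [Fintype V] (x : PathAlgebra k V) : 1 * x = x := by
  induction x using PathAlgebra.induction with
  | h0 => exact PathAlgebra.mul_zero _
  | hadd x y hx hy => rw [PathAlgebra.mul_add, hx, hy]
  | hpath r p => rw [PathAlgebra.mul_smul, sum_mul_ofPath]

protected theorem mul_one [Fintype V] (x : PathAlgebra k V) : x * 1 = x := by
  induction x using PathAlgebra.induction with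
  | h0 => exact PathAlgebra.zero_mul _
  | hadd x y hx hy => rw [PathAlgebra.add_mul, hx, hy]
  | hpath r p => rw [PathAlgebra.smul_mul, ofPath_mul_sum]

instance [Fintype V] : Ring (PathAlgebra k V) :=
  { (inferInstance : AddCommGroup (PathAlgebra k V)) with
    mul := (· * ·)
    one := 1
    left_distrib := PathAlgebra.mul_add
    right_distrib := PathAlgebra.add_mul
    zero_mul := PathAlgebra.zero_mul
    mul_zero := PathAlgebra.mul_zero
    mul_assoc := PathAlgebra.mul_assoc
    one_mul := PathAlgebra.one_mul
    mul_one := PathAlgebra.mul_one }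

instance [Fintype V] : Algebra k (PathAlgebra k V) :=
  Algebra.ofModule PathAlgebra.smul_mul PathAlgebra.mul_smul

end PathAlgebra

/-! ### Preprojective algebras

The double of the quiver `V` is `Quiver.Symmetrify V`: it has the same vertices, and its arrows
from `a` to `b` are the arrows `α : a ⟶ b` of `V` (written `Quiver.Hom.toPos α`) and one arrow
`α* : a ⟶ b` (written `Quiver.Hom.toNeg α`) for each arrow `α : b ⟶ a` of `V`. -/

instance (V : Type*) [Fintype V] : Fintype (Quiver.Symmetrify V) := inferInstanceAs (Fintype V)

section Preprojective

variable (k : Type*) {V : Type*} [Field k] [Fintype V] [Quiver V]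

/-- The path `α α*` of length two, as an element of the path algebra of the double. -/
def arrowStar {a b : V} (α : a ⟶ b) : PathAlgebra k (Quiver.Symmetrify V) :=
  PathAlgebra.ofPath k ⟨a, a, α.toPos.toPath.comp α.toNeg.toPath⟩

/-- The path `α* α` of length two, as an element of the path algebra of the double. -/
def starArrow {a b : V} (α : a ⟶ b) : PathAlgebra k (Quiver.Symmetrify V) :=
  PathAlgebra.ofPath k ⟨b, b, α.toNeg.toPath.comp α.toPos.toPath⟩

variable (V) [∀ a b : V, Fintype (a ⟶ b)]

/-- The element `∑ (α α* - α* α)`, summed over all arrows `α` of the quiver. -/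
def preprojectiveRelation : PathAlgebra k (Quiver.Symmetrify V) :=
  ∑ a : V, ∑ b : V, ∑ α : a ⟶ b, (arrowStar k α - starArrow k α)

/-- The preprojective algebra: the path algebra of the double modulo the two-sided ideal
generated by `preprojectiveRelation`. -/
abbrev PreprojectiveAlgebra :=
  RingQuot fun x y : PathAlgebra k (Quiver.Symmetrify V) =>
    x = preprojectiveRelation k V ∧ y = 0

/-- The quotient map. -/
def toPreprojective :
    PathAlgebra k (Quiver.Symmetrify V) →ₐ[k] PreprojectiveAlgebra k V :=
  RingQuot.mkAlgHom k _

variable {V}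

/-- The idempotent `e_i` given by the trivial path at `i`. -/
def idem (i : V) : PreprojectiveAlgebra k V :=
  toPreprojective k V (PathAlgebra.ofPath k ⟨i, i, Quiver.Path.nil⟩)

/-- The class of the arrow `α`. -/
def arrow {a b : V} (α : a ⟶ b) : PreprojectiveAlgebra k V :=
  toPreprojective k V (PathAlgebra.ofPath k ⟨a, b, α.toPos.toPath⟩)

/-- The class of the arrow `α*`. -/
def arrowDual {a b : V} (α : a ⟶ b) : PreprojectiveAlgebra k V :=
  toPreprojective k V (PathAlgebra.ofPath k ⟨b, a, α.toNeg.toPath⟩)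

variable (V) in
/-- The graded piece `A_s`, spanned by the classes of the paths of length `s`. -/
def piece (s : ℕ) : Submodule k (PreprojectiveAlgebra k V) :=
  Submodule.span k {x | ∃ p : AnyPath (Quiver.Symmetrify V), p.2.2.length = s ∧
    x = toPreprojective k V (PathAlgebra.ofPath k p)}

/-- The graded piece `e_i A_s` of the right module `e_i A`. -/
def rightPiece (i : V) (s : ℕ) : Submodule k (PreprojectiveAlgebra k V) :=
  (piece k V s).map (LinearMap.mulLeft k (idem k i))

/-- The graded piece `A_s e_i` of the left module `A e_i`. -/
def leftPiece (i : V) (s : ℕ) : Submodule k (PreprojectiveAlgebra k V) :=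
  (piece k V s).map (LinearMap.mulRight k (idem k i))

variable {k}

/-- An algebra automorphism is graded if it maps each graded piece onto itself. -/
def IsGradedAut (g : PreprojectiveAlgebra k V ≃ₐ[k] PreprojectiveAlgebra k V) : Prop :=
  ∀ s, (piece k V s).map (g.toLinearEquiv : _ →ₗ[k] _) = piece k V s

theorem map_rightPiece {g : PreprojectiveAlgebra k V ≃ₐ[k] PreprojectiveAlgebra k V}
    (hg : IsGradedAut g) {i : V} (hi : g (idem k i) = idem k i) (s : ℕ) :
    (rightPiece k i s).map (g.toLinearEquiv : _ →ₗ[k] _) = rightPiece k i s := by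
  conv_rhs => rw [rightPiece, ← hg s]
  rw [rightPiece, ← Submodule.map_comp, ← Submodule.map_comp]
  congr 1
  ext x
  simp [hi]

theorem map_leftPiece {g : PreprojectiveAlgebra k V ≃ₐ[k] PreprojectiveAlgebra k V}
    (hg : IsGradedAut g) {i : V} (hi : g (idem k i) = idem k i) (s : ℕ) :
    (leftPiece k i s).map (g.toLinearEquiv : _ →ₗ[k] _) = leftPiece k i s := by
  conv_rhs => rw [leftPiece, ← hg s]
  rw [leftPiece, ← Submodule.map_comp, ← Submodule.map_comp]
  congr 1
  ext x
  simp [hi]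

/-- The restriction of `g` to `e_i A`, degree by degree. -/
def restrictRight {g : PreprojectiveAlgebra k V ≃ₐ[k] PreprojectiveAlgebra k V}
    (hg : IsGradedAut g) {i : V} (hi : g (idem k i) = idem k i) (s : ℕ) :
    rightPiece k i s ≃ₗ[k] rightPiece k i s :=
  g.toLinearEquiv.ofSubmodules _ _ (map_rightPiece hg hi s)

/-- The restriction of `g` to `A e_i`, degree by degree. -/
def restrictLeft {g : PreprojectiveAlgebra k V ≃ₐ[k] PreprojectiveAlgebra k V}
    (hg : IsGradedAut g) {i : V} (hi : g (idem k i) = idem k i) (s : ℕ) :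
    leftPiece k i s ≃ₗ[k] leftPiece k i s :=
  g.toLinearEquiv.ofSubmodules _ _ (map_leftPiece hg hi s)

end Preprojective

/-! ### Trace series -/

/-- The trace series `∑ tr(φ|_{M_s}) t^s` of a graded automorphism `φ` of an `ℕ`-graded vector
space `M` with graded pieces `M s`. -/
def traceSeries {k : Type*} [Field k] {M : ℕ → Type*} [∀ s, AddCommGroup (M s)]
    [∀ s, Module k (M s)] (φ : ∀ s, M s ≃ₗ[k] M s) : PowerSeries k :=
  PowerSeries.mk fun s => LinearMap.trace k (M s) (φ s : M s →ₗ[k] M s)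

/-- The rational function `F` has the power series `f` as its expansion at `t = 0`. -/
def HasExpansion {k : Type*} [Field k] (F : RatFunc k) (f : PowerSeries k) : Prop :=
  (F : LaurentSeries k) = (f : LaurentSeries k)

/-- The rational function `F(t⁻¹)`. -/
def invVar {k : Type*} [Field k] (F : RatFunc k) : RatFunc k :=
  F.eval RatFunc.C (RatFunc.X)⁻¹

/-! ### Extended Dynkin quivers -/

/-- The extended Dynkin types: `A m` is the type `Ã_{m+1}` (with `m + 2` vertices), `D m` is the
type `D̃_{m+4}` (with `m + 5` vertices), and `E6`, `E7`, `E8` are `Ẽ_6`, `Ẽ_7`, `Ẽ_8`. -/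
inductive ExtendedDynkinType
  | A (m : ℕ)
  | D (m : ℕ)
  | E6
  | E7
  | E8

/-- The number of vertices of the extended Dynkin graph; the vertices are `0, 1, …`. -/
def ExtendedDynkinType.order : ExtendedDynkinType → ℕ
  | A m => m + 2
  | D m => m + 5
  | E6 => 7
  | E7 => 8
  | E8 => 9

/-- The edges of the extended Dynkin graph. For `A m` they form a cycle of length `m + 2` (two
parallel edges for `m = 0`). For `D m` they form a chain `2, …, m + 2` with two further vertices
attached at each of its ends (all four at the same vertex for `m = 0`). -/
def ExtendedDynkinType.edges : ExtendedDynkinType → List (ℕ × ℕ)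
  | A m => (List.range (m + 1)).map (fun j => (j, j + 1)) ++ [(m + 1, 0)]
  | D m => [(0, 2), (1, 2)] ++ (List.range m).map (fun j => (j + 2, j + 3)) ++
      [(m + 2, m + 3), (m + 2, m + 4)]
  | E6 => [(0, 1), (1, 2), (2, 3), (3, 4), (2, 5), (5, 6)]
  | E7 => [(0, 1), (1, 2), (2, 3), (3, 4), (4, 5), (5, 6), (3, 7)]
  | E8 => [(0, 1), (1, 2), (2, 3), (3, 4), (4, 5), (5, 6), (6, 7), (5, 8)]

/-- A quiver is an extended Dynkin quiver if the multigraph that is left when one forgets the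
orientation of its arrows is isomorphic to an extended Dynkin graph: `φ` matches the vertices and
`σ` matches the arrows with the edges. -/
def IsExtendedDynkin (V : Type*) [Quiver V] : Prop :=
  ∃ (T : ExtendedDynkinType) (φ : V ≃ Fin T.order)
    (σ : (Σ a b : V, (a ⟶ b)) ≃ Fin T.edges.length),
    ∀ (a b : V) (α : a ⟶ b),
      s((φ a : ℕ), (φ b : ℕ)) =
        s((T.edges.get (σ ⟨a, b, α⟩)).1, (T.edges.get (σ ⟨a, b, α⟩)).2)

end Preproj

end

/-! Write `cell k i s j` for `e_i A_s e_j`. For every quiver the relation at `j` yields a sequence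
`e_i A_s e_j → ⨁ e_i A_{s+1} e_h → e_i A_{s+2} e_j → 0`, the sum running over the arrows `a : h ⟶ j`
of the double. Its maps are `spread`, `x ↦ (± x a*)_a`, and `gather`, `(x_a) ↦ ∑ x_a a`. It is exact
(`exists_spread_eq`, `gather_surjective`), because a linear dependence between products `x_a a` can
only come from relations that end in the last two arrows.

In extended Dynkin type `spread` is moreover injective (`spread_injective`). By induction on the
degree, the dimensions weighted by the minimal imaginary root `δ` satisfy `D (n + 2) = 2 D (n + 1) -
D n`, so that `D n = (n + 1) δ_i` and the next degree is nonzero. An element killed by all arrows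
would then give a rank-one endomorphism compatible with right multiplication; such endomorphisms are
scalars, and this one would have to be both zero and nonzero.

Since `g` preserves the relation at each vertex and the quiver is connected, `c_α t_α` is a single
constant `λ`. With `w a` the scalar of `a`, twisting by `w a` in the middle and by `λ` on the left
makes `g` act on the sequence. Traces then give `v_{s+2} = v_{s+1} C - λ v_s` with `C h j = ∑ w a`,
hence `∑ v_s t^s` is row `i` of `(1 - tC + λt²)⁻¹`.

Reversing paths carries `g⁻¹` on `A_s e_i` to `λ^{-s} g` on `e_i A_s`, so the left series is the
right one with `t` replaced by `t/λ`. Under `t ↦ t⁻¹` the matrix `1 - λ⁻¹tC + λ⁻¹t²` becomes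
`(λt²)⁻¹ (1 - tC + λt²)`, and inverting it produces the factor `λt²`. -/

noncomputable section

namespace Preproj

open Quiver

/-! ### The kernel of the quotient map, spanned by the relations between two paths -/

section Kernel

variable (k : Type*) {V : Type*} [Field k] [Quiver V]

/-- The sign of an arrow `a` of the double in the relation `∑ ± a* a`. -/
def sgn {h j : Symmetrify V} (a : h ⟶ j) : k := Sum.elim (fun _ => -1) (fun _ => 1) a

theorem sgn_mul_self {h j : Symmetrify V} (a : h ⟶ j) : sgn k a * sgn k a = 1 := by
  rcases a with a | a <;> simp [sgn]

theorem sgn_ne_zero {h j : Symmetrify V} (a : h ⟶ j) : sgn k a ≠ 0 := by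
  intro h0
  have := sgn_mul_self k a
  simp [h0] at this

variable [Fintype V] [∀ a b : V, Fintype (a ⟶ b)]

instance (a b : Symmetrify V) : Fintype (a ⟶ b) :=
  inferInstanceAs (Fintype (Sum ((show V from a) ⟶ (show V from b))
    ((show V from b) ⟶ (show V from a))))

/-- The relation at the vertex `j`, multiplied by a path ending at `j` and a path starting
at `j`. -/
def relElt {i j l : Symmetrify V} (p : Path i j) (q : Path j l) :
    PathAlgebra k (Symmetrify V) :=
  ∑ h : Symmetrify V, ∑ a : h ⟶ j,
    sgn k a • PathAlgebra.ofPath k ⟨i, l, ((p.cons (reverse a)).cons a).comp q⟩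

variable {k}

theorem PathAlgebra.mul_comp {W : Type*} [Quiver W] {a b c : W} (p : Path a b) (q : Path b c) :
    (PathAlgebra.ofPath k ⟨a, b, p⟩ * PathAlgebra.ofPath k ⟨b, c, q⟩ : PathAlgebra k W) =
      PathAlgebra.ofPath k ⟨a, c, p.comp q⟩ := by
  rw [PathAlgebra.ofPath_mul_ofPath, PathAlgebra.pathMul_comp]

theorem PathAlgebra.mul_of_ne {W : Type*} [Quiver W] {a b b' c : W} (p : Path a b)
    (q : Path b' c) (h : b ≠ b') :
    (PathAlgebra.ofPath k ⟨a, b, p⟩ * PathAlgebra.ofPath k ⟨b', c, q⟩ : PathAlgebra k W) = 0 := by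
  rw [PathAlgebra.ofPath_mul_ofPath, PathAlgebra.pathMul_of_ne h]

-- The global relation is split by vertices: at `j`, an arrow ending there contributes `-α*α` and
-- one starting there contributes `αα*`.
variable (k V) in
theorem preprojectiveRelation_eq :
    preprojectiveRelation k V = ∑ j : Symmetrify V, relElt k (Path.nil : Path j j) Path.nil := by
  have hsum : ∀ j h : V, (∑ a : (show Symmetrify V from h) ⟶ (show Symmetrify V from j),
      sgn k a • PathAlgebra.ofPath k (V := Symmetrify V)
        ⟨j, j, (((Path.nil : Path (V := Symmetrify V) j j).cons (reverse a)).cons a).comp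
          Path.nil⟩) =
      (∑ α : h ⟶ j, -starArrow k α) + ∑ α : j ⟶ h, arrowStar k α := by
    intro j h
    refine (Fintype.sum_sum_type (α₁ := h ⟶ j) (α₂ := j ⟶ h) _).trans ?_
    congr 1
    · refine Finset.sum_congr rfl fun α _ => ?_
      simp only [sgn, Sum.elim_inl, neg_smul, one_smul]
      rfl
    · refine Finset.sum_congr rfl fun α _ => ?_
      simp only [sgn, Sum.elim_inr, one_smul]
      rfl
  have h1 : (∑ j : Symmetrify V, relElt k (Path.nil : Path j j) Path.nil) =
      ∑ j : V, ∑ h : V, ((∑ α : h ⟶ j, -starArrow k α) + ∑ α : j ⟶ h, arrowStar k α) :=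
    Finset.sum_congr rfl fun j _ => Finset.sum_congr rfl fun h _ => hsum j h
  rw [h1, preprojectiveRelation]
  simp only [Finset.sum_add_distrib, Finset.sum_sub_distrib, Finset.sum_neg_distrib]
  rw [Finset.sum_comm (f := fun j h : V => ∑ α : h ⟶ j, starArrow k α)]
  abel

theorem ofPath_mul_relElt {i j l m : Symmetrify V} (r : Path m i) (p : Path i j) (q : Path j l) :
    PathAlgebra.ofPath k ⟨m, i, r⟩ * relElt k p q = relElt k (r.comp p) q := by
  simp only [relElt, Finset.mul_sum, mul_smul_comm, PathAlgebra.mul_comp]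
  simp [Path.comp_assoc, ← Path.comp_cons]

theorem relElt_mul_ofPath {i j l m : Symmetrify V} (r : Path l m) (p : Path i j) (q : Path j l) :
    relElt k p q * PathAlgebra.ofPath k ⟨l, m, r⟩ = relElt k p (q.comp r) := by
  simp only [relElt, Finset.sum_mul, smul_mul_assoc, PathAlgebra.mul_comp, Path.comp_assoc]

theorem ofPath_mul_relElt_of_ne {i i' j l m : Symmetrify V} (r : Path m i') (p : Path i j)
    (q : Path j l) (h : i' ≠ i) :
    PathAlgebra.ofPath k ⟨m, i', r⟩ * relElt k p q = 0 := by
  simp only [relElt, Finset.mul_sum, mul_smul_comm, PathAlgebra.mul_of_ne _ _ h, smul_zero,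
    Finset.sum_const_zero]

theorem relElt_mul_ofPath_of_ne {i j l l' m : Symmetrify V} (r : Path l' m) (p : Path i j)
    (q : Path j l) (h : l ≠ l') :
    relElt k p q * PathAlgebra.ofPath k ⟨l', m, r⟩ = 0 := by
  simp only [relElt, Finset.sum_mul, smul_mul_assoc, PathAlgebra.mul_of_ne _ _ h, smul_zero,
    Finset.sum_const_zero]

variable (k V) in
/-- The linear span of the relations multiplied by paths on both sides. -/
def relSpan : Submodule k (PathAlgebra k (Symmetrify V)) :=
  Submodule.span k {x | ∃ (i j l : Symmetrify V) (p : Path i j) (q : Path j l), x = relElt k p q}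

theorem relElt_mem {i j l : Symmetrify V} (p : Path i j) (q : Path j l) :
    relElt k p q ∈ relSpan k V := Submodule.subset_span ⟨i, j, l, p, q, rfl⟩

theorem mul_mem_relSpan_left (x : PathAlgebra k (Symmetrify V))
    {y : PathAlgebra k (Symmetrify V)} (hy : y ∈ relSpan k V) : x * y ∈ relSpan k V := by
  induction hy using Submodule.span_induction with
  | zero => simp
  | add u v _ _ hu hv => rw [mul_add]; exact add_mem hu hv
  | smul r u _ hu => rw [mul_smul_comm]; exact Submodule.smul_mem _ _ hu
  | mem y hy =>
    obtain ⟨i, j, l, p, q, rfl⟩ := hy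
    induction x using PathAlgebra.induction with
    | h0 => simp
    | hadd u v hu hv => rw [add_mul]; exact add_mem hu hv
    | hpath c r =>
      rw [smul_mul_assoc]
      refine Submodule.smul_mem _ _ ?_
      obtain ⟨m, i', r⟩ := r
      by_cases h : i' = i
      · subst h
        rw [ofPath_mul_relElt]
        exact relElt_mem _ _
      · rw [ofPath_mul_relElt_of_ne _ _ _ h]
        exact zero_mem _

theorem mul_mem_relSpan_right {x : PathAlgebra k (Symmetrify V)}
    (y : PathAlgebra k (Symmetrify V)) (hx : x ∈ relSpan k V) : x * y ∈ relSpan k V := by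
  induction hx using Submodule.span_induction with
  | zero => simp
  | add u v _ _ hu hv => rw [add_mul]; exact add_mem hu hv
  | smul r u _ hu => rw [smul_mul_assoc]; exact Submodule.smul_mem _ _ hu
  | mem x hx =>
    obtain ⟨i, j, l, p, q, rfl⟩ := hx
    induction y using PathAlgebra.induction with
    | h0 => simp
    | hadd u v hu hv => rw [mul_add]; exact add_mem hu hv
    | hpath c r =>
      rw [mul_smul_comm]
      refine Submodule.smul_mem _ _ ?_
      obtain ⟨l', m, r⟩ := r
      by_cases h : l = l'
      · subst h
        rw [relElt_mul_ofPath]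
        exact relElt_mem _ _
      · rw [relElt_mul_ofPath_of_ne _ _ _ h]
        exact zero_mem _

variable (k V) in
/-- The two-sided ideal with underlying set `relSpan k V`. -/
def relIdeal : TwoSidedIdeal (PathAlgebra k (Symmetrify V)) :=
  TwoSidedIdeal.mk' (relSpan k V) (zero_mem _) (fun h h' => add_mem h h') (fun h => neg_mem h)
    (fun h => mul_mem_relSpan_left _ h) (fun h => mul_mem_relSpan_right _ h)

theorem mem_relIdeal {x : PathAlgebra k (Symmetrify V)} : x ∈ relIdeal k V ↔ x ∈ relSpan k V :=
  TwoSidedIdeal.mem_mk' ..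

/-- The span of the `relElt` is already a two-sided ideal containing the defining relation, so the
quotient by it factors through `RingQuot`. This makes the kernel accessible to linear algebra. -/
theorem mem_relSpan_of_toPreprojective_eq_zero {x : PathAlgebra k (Symmetrify V)}
    (hx : toPreprojective k V x = 0) : x ∈ relSpan k V := by
  have hrel : ∀ ⦃x y : PathAlgebra k (Symmetrify V)⦄, (x = preprojectiveRelation k V ∧ y = 0) →
      (relIdeal k V).ringCon.mk' x = (relIdeal k V).ringCon.mk' y := by
    rintro x y ⟨rfl, rfl⟩
    rw [← TwoSidedIdeal.ker_ringCon, TwoSidedIdeal.rel_iff, TwoSidedIdeal.ker_ringCon_mk',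
      sub_zero, mem_relIdeal, preprojectiveRelation_eq]
    exact sum_mem fun j _ => relElt_mem _ _
  have h1 : RingQuot.lift ⟨(relIdeal k V).ringCon.mk', hrel⟩ (toPreprojective k V x) =
      (relIdeal k V).ringCon.mk' x := by
    rw [← RingQuot.lift_mkRingHom_apply (relIdeal k V).ringCon.mk' hrel x, toPreprojective]
    congr 1
    exact DFunLike.congr_fun (RingQuot.mkAlgHom_coe k _) x
  rw [hx, map_zero] at h1
  rw [← mem_relIdeal, ← TwoSidedIdeal.ker_ringCon_mk' (relIdeal k V), TwoSidedIdeal.mem_ker, h1]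

theorem toPreprojective_preprojectiveRelation :
    toPreprojective k V (preprojectiveRelation k V) = 0 := by
  rw [toPreprojective, ← map_zero (RingQuot.mkAlgHom k _)]
  exact RingQuot.mkAlgHom_rel k ⟨rfl, rfl⟩

theorem toPreprojective_relElt {i j l : Symmetrify V} (p : Path i j) (q : Path j l) :
    toPreprojective k V (relElt k p q) = 0 := by
  have h : relElt k p q = PathAlgebra.ofPath k ⟨i, j, p⟩ * preprojectiveRelation k V *
      PathAlgebra.ofPath k ⟨j, l, q⟩ := by
    rw [preprojectiveRelation_eq, Finset.mul_sum, Finset.sum_mul, Finset.sum_eq_single j]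
    · rw [ofPath_mul_relElt, relElt_mul_ofPath, Path.comp_nil, Path.nil_comp]
    · intro j' _ hj'
      rw [ofPath_mul_relElt_of_ne _ _ _ hj'.symm, zero_mul]
    · simp
  rw [h, map_mul, map_mul, toPreprojective_preprojectiveRelation, mul_zero, zero_mul]

theorem toPreprojective_surjective : Function.Surjective (toPreprojective k V) :=
  RingQuot.mkAlgHom_surjective k _

/-- This builds maps out of `A` that need not be multiplicative, such as projections onto cells and
path reversal. -/
theorem exists_linearMap_preprojective {M : Type*} [AddCommGroup M] [Module k M]
    (L : PathAlgebra k (Symmetrify V) →ₗ[k] M)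
    (hL : ∀ {i j l : Symmetrify V} (p : Path i j) (q : Path j l), L (relElt k p q) = 0) :
    ∃ f : PreprojectiveAlgebra k V →ₗ[k] M, ∀ x, f (toPreprojective k V x) = L x := by
  have hker : LinearMap.ker (toPreprojective k V).toLinearMap ≤ LinearMap.ker L := by
    intro x hx
    have hx' := mem_relSpan_of_toPreprojective_eq_zero hx
    refine (Submodule.span_le (p := LinearMap.ker L)).2 ?_ hx'
    rintro _ ⟨i, j, l, p, q, rfl⟩
    exact hL p q
  refine ⟨(LinearMap.ker (toPreprojective k V).toLinearMap).liftQ L hker ∘ₗ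
    ((toPreprojective k V).toLinearMap.quotKerEquivOfSurjective
      toPreprojective_surjective).symm.toLinearMap, fun x => ?_⟩
  have h2 : ((toPreprojective k V).toLinearMap.quotKerEquivOfSurjective
      toPreprojective_surjective).symm (toPreprojective k V x) = Submodule.Quotient.mk x := by
    rw [LinearEquiv.symm_apply_eq]
    rfl
  simp only [LinearMap.comp_apply, LinearEquiv.coe_coe, h2, Submodule.liftQ_apply]

end Kernel

/-! ### The decomposition of the algebra into the spaces `e_i A_s e_j` -/

section Cells

variable {k : Type*} {V : Type*} [Field k] [Fintype V] [Quiver V] [∀ a b : V, Fintype (a ⟶ b)]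

variable (k) in
/-- The class of a path in the preprojective algebra. -/
def pathClass {i j : Symmetrify V} (p : Path i j) : PreprojectiveAlgebra k V :=
  toPreprojective k V (PathAlgebra.ofPath k ⟨i, j, p⟩)

variable (k) in
/-- The class of an arrow of the double. -/
def arrowClass {i j : Symmetrify V} (a : i ⟶ j) : PreprojectiveAlgebra k V :=
  pathClass k a.toPath

theorem pathClass_mul {i j l : Symmetrify V} (p : Path i j) (q : Path j l) :
    pathClass k p * pathClass k q = pathClass k (p.comp q) := by
  rw [pathClass, pathClass, ← map_mul, PathAlgebra.mul_comp, pathClass]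

theorem pathClass_mul_of_ne {i j j' l : Symmetrify V} (p : Path i j) (q : Path j' l)
    (h : j ≠ j') : pathClass k p * pathClass k q = 0 := by
  rw [pathClass, pathClass, ← map_mul, PathAlgebra.mul_of_ne _ _ h, map_zero]

theorem pathClass_cons {i j l : Symmetrify V} (p : Path i j) (a : j ⟶ l) :
    pathClass k (p.cons a) = pathClass k p * arrowClass k a := by
  rw [arrowClass, pathClass_mul]
  rfl

theorem sum_sgn_smul_pathClass {i j l : Symmetrify V} (p : Path i j) (q : Path j l) :
    ∑ h : Symmetrify V, ∑ a : h ⟶ j,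
      sgn k a • pathClass k (((p.cons (reverse a)).cons a).comp q) = 0 := by
  have := toPreprojective_relElt (k := k) p q
  simp only [relElt, map_sum, map_smul] at this
  exact this

theorem span_pathClass : Submodule.span k
    {x : PreprojectiveAlgebra k V | ∃ (i j : Symmetrify V) (p : Path i j), x = pathClass k p} =
      ⊤ := by
  rw [eq_top_iff]
  intro x _
  obtain ⟨x, rfl⟩ := toPreprojective_surjective x
  induction x using PathAlgebra.induction with
  | h0 => simp
  | hadd u v hu hv => rw [map_add]; exact add_mem (hu trivial) (hv trivial)
  | hpath r p =>
    rw [map_smul]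
    exact Submodule.smul_mem _ _ (Submodule.subset_span ⟨p.1, p.2.1, p.2.2, rfl⟩)

theorem linearMap_ext_pathClass {M : Type*} [AddCommGroup M] [Module k M]
    {f f' : PreprojectiveAlgebra k V →ₗ[k] M}
    (h : ∀ {i j : Symmetrify V} (p : Path i j), f (pathClass k p) = f' (pathClass k p)) :
    f = f' := by
  refine LinearMap.ext_on span_pathClass ?_
  rintro _ ⟨i, j, p, rfl⟩
  exact h p

theorem exists_linearMap_pathClass {M : Type*} [AddCommGroup M] [Module k M]
    (F : ∀ {i j : Symmetrify V}, Path i j → M)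
    (hF : ∀ {i j l : Symmetrify V} (p : Path i j) (q : Path j l),
      ∑ h : Symmetrify V, ∑ a : h ⟶ j,
        sgn k a • F (((p.cons (reverse a)).cons a).comp q) = 0) :
    ∃ f : PreprojectiveAlgebra k V →ₗ[k] M,
      ∀ {i j : Symmetrify V} (p : Path i j), f (pathClass k p) = F p := by
  let L : PathAlgebra k (Symmetrify V) →ₗ[k] M :=
    Finsupp.linearCombination k fun p : AnyPath (Symmetrify V) => F p.2.2
  have hL : ∀ p : AnyPath (Symmetrify V), L (PathAlgebra.ofPath k p) = F p.2.2 := by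
    intro p
    have := Finsupp.linearCombination_single k (1 : k) p
      (v := fun p : AnyPath (Symmetrify V) => F p.2.2)
    rw [one_smul] at this
    exact this
  obtain ⟨f, hf⟩ := exists_linearMap_preprojective L (by
    intro i j l p q
    simp only [relElt, map_sum, map_smul, hL]
    exact hF p q)
  exact ⟨f, fun p => by rw [pathClass, hf, hL]⟩

/-- All terms of a relation share their endpoints and their length, so a projection defined on paths
keeps or kills a relation as a whole. -/
theorem exists_cellProj (i : Symmetrify V) (s : ℕ) (j : Symmetrify V) :
    ∃ f : PreprojectiveAlgebra k V →ₗ[k] PreprojectiveAlgebra k V,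
      (∀ p : Path i j, p.length = s → f (pathClass k p) = pathClass k p) ∧
      ∀ {i' j' : Symmetrify V} (p : Path i' j'), ¬ (i' = i ∧ j' = j ∧ p.length = s) →
        f (pathClass k p) = 0 := by
  classical
  obtain ⟨f, hf⟩ := exists_linearMap_pathClass (k := k) (V := V)
    (M := PreprojectiveAlgebra k V)
    (fun {i' j'} p => if i' = i ∧ j' = j ∧ p.length = s then pathClass k p else 0) (by
      intro i' j' l p q
      simp only [Path.length_comp, Path.length_cons]
      split_ifs
      · exact sum_sgn_smul_pathClass p q
      · simp)
  refine ⟨f, fun p hp => ?_, fun p hp => ?_⟩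
  · rw [hf, if_pos ⟨rfl, rfl, hp⟩]
  · rw [hf, if_neg hp]

variable (k) in
/-- The projection of the preprojective algebra onto the span of the classes of the paths of
length `s` from `i` to `j`. -/
def cellProj (i : Symmetrify V) (s : ℕ) (j : Symmetrify V) :
    PreprojectiveAlgebra k V →ₗ[k] PreprojectiveAlgebra k V :=
  (exists_cellProj (k := k) i s j).choose

theorem cellProj_pathClass {i : Symmetrify V} {s : ℕ} {j : Symmetrify V} (p : Path i j)
    (hp : p.length = s) : cellProj k i s j (pathClass k p) = pathClass k p :=
  (exists_cellProj (k := k) i s j).choose_spec.1 p hp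

theorem cellProj_pathClass_of_not {i : Symmetrify V} {s : ℕ} {j i' j' : Symmetrify V}
    (p : Path i' j') (hp : ¬ (i' = i ∧ j' = j ∧ p.length = s)) :
    cellProj k i s j (pathClass k p) = 0 :=
  (exists_cellProj (k := k) i s j).choose_spec.2 p hp

variable (k) in
/-- The span of the classes of the paths of length `s` from `i` to `j`, that is `e_i A_s e_j`. -/
def cell (i : Symmetrify V) (s : ℕ) (j : Symmetrify V) :
    Submodule k (PreprojectiveAlgebra k V) :=
  Submodule.span k {x | ∃ p : Path i j, p.length = s ∧ x = pathClass k p}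

theorem pathClass_mem_cell {i : Symmetrify V} {s : ℕ} {j : Symmetrify V} (p : Path i j)
    (hp : p.length = s) : pathClass k p ∈ cell k i s j :=
  Submodule.subset_span ⟨p, hp, rfl⟩

theorem cellProj_mem (i : Symmetrify V) (s : ℕ) (j : Symmetrify V)
    (x : PreprojectiveAlgebra k V) : cellProj k i s j x ∈ cell k i s j := by
  have hx : x ∈ (⊤ : Submodule k (PreprojectiveAlgebra k V)) := trivial
  rw [← span_pathClass] at hx
  induction hx using Submodule.span_induction with
  | zero => simp
  | add u v _ _ hu hv => rw [map_add]; exact add_mem hu hv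
  | smul r u _ hu => rw [map_smul]; exact Submodule.smul_mem _ _ hu
  | mem x hx =>
    obtain ⟨i', j', p, rfl⟩ := hx
    by_cases h : i' = i ∧ j' = j ∧ p.length = s
    · obtain ⟨rfl, rfl, hp⟩ := h
      rw [cellProj_pathClass p hp]
      exact pathClass_mem_cell p hp
    · rw [cellProj_pathClass_of_not p h]
      exact zero_mem _

theorem cellProj_of_mem {i : Symmetrify V} {s : ℕ} {j : Symmetrify V}
    {x : PreprojectiveAlgebra k V} (hx : x ∈ cell k i s j) : cellProj k i s j x = x := by
  induction hx using Submodule.span_induction with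
  | zero => simp
  | add u v _ _ hu hv => rw [map_add, hu, hv]
  | smul r u _ hu => rw [map_smul, hu]
  | mem x hx =>
    obtain ⟨p, hp, rfl⟩ := hx
    exact cellProj_pathClass p hp

theorem mul_pathClass_nil_of_mem {i : Symmetrify V} {s : ℕ} {j : Symmetrify V}
    {x : PreprojectiveAlgebra k V} (hx : x ∈ cell k i s j) :
    x * pathClass k (Path.nil : Path j j) = x := by
  induction hx using Submodule.span_induction with
  | zero => simp
  | add u v _ _ hu hv => rw [add_mul, hu, hv]
  | smul r u _ hu => rw [smul_mul_assoc, hu]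
  | mem x hx =>
    obtain ⟨p, hp, rfl⟩ := hx
    rw [pathClass_mul, Path.comp_nil]

theorem mul_arrowClass_mem {i : Symmetrify V} {s : ℕ} {j l : Symmetrify V}
    {x : PreprojectiveAlgebra k V} (hx : x ∈ cell k i s j) (a : j ⟶ l) :
    x * arrowClass k a ∈ cell k i (s + 1) l := by
  induction hx using Submodule.span_induction with
  | zero => simp
  | add u v _ _ hu hv => rw [add_mul]; exact add_mem hu hv
  | smul r u _ hu => rw [smul_mul_assoc]; exact Submodule.smul_mem _ _ hu
  | mem x hx =>
    obtain ⟨p, hp, rfl⟩ := hx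
    rw [← pathClass_cons]
    exact pathClass_mem_cell _ (by simp [hp])

theorem sum_sgn_smul_mul {i : Symmetrify V} {s : ℕ} {j : Symmetrify V}
    {x : PreprojectiveAlgebra k V} (hx : x ∈ cell k i s j) :
    ∑ h : Symmetrify V, ∑ a : h ⟶ j,
      sgn k a • (x * arrowClass k (reverse a) * arrowClass k a) = 0 := by
  induction hx using Submodule.span_induction with
  | zero => simp
  | add u v _ _ hu hv =>
    simp only [add_mul, smul_add, Finset.sum_add_distrib, hu, hv, add_zero]
  | smul r u _ hu =>
    simp only [smul_mul_assoc, smul_comm _ r, ← Finset.smul_sum, hu, smul_zero]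
  | mem x hx =>
    obtain ⟨p, hp, rfl⟩ := hx
    simpa only [← pathClass_cons, Path.comp_nil] using sum_sgn_smul_pathClass p Path.nil

theorem cellProj_succ_mul (i : Symmetrify V) (s : ℕ) {j l : Symmetrify V}
    (x : PreprojectiveAlgebra k V) (a : j ⟶ l) :
    cellProj k i (s + 1) l (x * arrowClass k a) = cellProj k i s j x * arrowClass k a := by
  have : cellProj k i (s + 1) l ∘ₗ LinearMap.mulRight k (arrowClass k a) =
      LinearMap.mulRight k (arrowClass k a) ∘ₗ cellProj k i s j := by
    refine linearMap_ext_pathClass fun {i' j'} p => ?_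
    simp only [LinearMap.comp_apply, LinearMap.mulRight_apply]
    by_cases hj : j' = j
    · subst hj
      rw [← pathClass_cons]
      by_cases h : i' = i ∧ p.length = s
      · obtain ⟨rfl, hs⟩ := h
        rw [cellProj_pathClass _ (by simp [hs]), cellProj_pathClass _ hs, pathClass_cons]
      · rw [cellProj_pathClass_of_not _ (by simpa using h), cellProj_pathClass_of_not, zero_mul]
        tauto
    · rw [arrowClass, pathClass_mul_of_ne _ _ hj, map_zero, cellProj_pathClass_of_not,
        zero_mul]
      tauto
  exact LinearMap.congr_fun this x

theorem cellProj_zero_mul (i : Symmetrify V) {j l : Symmetrify V}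
    (x : PreprojectiveAlgebra k V) (a : j ⟶ l) :
    cellProj k i 0 l (x * arrowClass k a) = 0 := by
  have : cellProj k i 0 l ∘ₗ LinearMap.mulRight k (arrowClass k a) = 0 := by
    refine linearMap_ext_pathClass fun {i' j'} p => ?_
    simp only [LinearMap.comp_apply, LinearMap.mulRight_apply, LinearMap.zero_apply]
    by_cases hj : j' = j
    · subst hj
      rw [← pathClass_cons, cellProj_pathClass_of_not _ (by simp)]
    · rw [arrowClass, pathClass_mul_of_ne _ _ hj, map_zero]
  exact LinearMap.congr_fun this x

theorem pathClass_nil_ne_zero (j : Symmetrify V) : pathClass k (Path.nil : Path j j) ≠ 0 := by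
  classical
  obtain ⟨f, hf⟩ := exists_linearMap_pathClass (k := k) (V := V) (M := k)
    (fun {i' j'} p => if p.length = 0 then 1 else 0) (by simp)
  intro h
  have := hf (Path.nil : Path j j)
  simp [h] at this

end Cells

/-! ### Exactness in the middle, by removing the last arrow -/

section Exactness

variable {k : Type*} {V : Type*} [Field k] [Fintype V] [Quiver V] [∀ a b : V, Fintype (a ⟶ b)]

open Classical in
variable (k) in
/-- The class of a path with its last arrow removed if that arrow is `a`, and `0` otherwise. -/
def dropLast {h j : Symmetrify V} (a : h ⟶ j) :
    ∀ {i l : Symmetrify V}, Path i l → PreprojectiveAlgebra k V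
  | _, _, Path.nil => 0
  | _, _, Path.cons (b := m) (c := l) p b =>
    if (⟨m, l, b⟩ : Σ m l : Symmetrify V, m ⟶ l) = ⟨h, j, a⟩ then pathClass k p else 0

variable (k) in
/-- The linear extension of `dropLast` to the path algebra. -/
def dropLastHom {h j : Symmetrify V} (a : h ⟶ j) :
    PathAlgebra k (Symmetrify V) →ₗ[k] PreprojectiveAlgebra k V :=
  Finsupp.linearCombination k fun p : AnyPath (Symmetrify V) => dropLast k a p.2.2

theorem dropLastHom_ofPath {h j : Symmetrify V} (a : h ⟶ j) (p : AnyPath (Symmetrify V)) :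
    dropLastHom k a (PathAlgebra.ofPath k p) = dropLast k a p.2.2 := by
  have := Finsupp.linearCombination_single k (1 : k) p
    (v := fun p : AnyPath (Symmetrify V) => dropLast k a p.2.2)
  rw [one_smul] at this
  exact this

theorem dropLastHom_mul_self {h j : Symmetrify V} (a : h ⟶ j)
    (x : PathAlgebra k (Symmetrify V)) :
    dropLastHom k a (x * PathAlgebra.ofPath k ⟨h, j, a.toPath⟩) =
      toPreprojective k V x * pathClass k (Path.nil : Path h h) := by
  induction x using PathAlgebra.induction with
  | h0 => simp
  | hadd u v hu hv => rw [add_mul, map_add, hu, hv, map_add, add_mul]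
  | hpath r p =>
    rw [smul_mul_assoc, map_smul, map_smul, smul_mul_assoc]
    congr 1
    obtain ⟨i, l, p⟩ := p
    by_cases hl : l = h
    · subst hl
      rw [PathAlgebra.mul_comp, dropLastHom_ofPath, ← pathClass, pathClass_mul, Path.comp_nil]
      exact if_pos rfl
    · rw [PathAlgebra.mul_of_ne _ _ hl, map_zero, ← pathClass, pathClass_mul_of_ne _ _ hl]

theorem dropLastHom_mul_of_ne {h h' j : Symmetrify V} (a : h ⟶ j) (b : h' ⟶ j)
    (hab : (⟨h', b⟩ : Σ m : Symmetrify V, m ⟶ j) ≠ ⟨h, a⟩) (x : PathAlgebra k (Symmetrify V)) :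
    dropLastHom k a (x * PathAlgebra.ofPath k ⟨h', j, b.toPath⟩) = 0 := by
  induction x using PathAlgebra.induction with
  | h0 => simp
  | hadd u v hu hv => rw [add_mul, map_add, hu, hv, add_zero]
  | hpath r p =>
    rw [smul_mul_assoc, map_smul]
    obtain ⟨i, l, p⟩ := p
    by_cases hl : l = h'
    · subst hl
      rw [PathAlgebra.mul_comp, dropLastHom_ofPath]
      refine (congrArg _ (if_neg ?_)).trans (smul_zero _)
      intro he
      apply hab
      cases he
      rfl
    · rw [PathAlgebra.mul_of_ne _ _ hl, map_zero, smul_zero]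

/-- The core of exactness. If `q` is nonempty, removing its last arrow leaves a relation, which
vanishes in `A`. If `q` is trivial, the last arrow belongs to the relation itself and what remains
is `± p a*`. The same `y` serves all arrows ending at `j`. -/
theorem exists_dropLastHom_relElt {i m l : Symmetrify V} (p : Path i m) (q : Path m l)
    (j : Symmetrify V) :
    ∃ y : PreprojectiveAlgebra k V, ∀ (h : Symmetrify V) (a : h ⟶ j),
      dropLastHom k a (relElt k p q) = sgn k a • (y * arrowClass k (reverse a)) := by
  classical
  cases q with
  | nil =>
    by_cases hm : m = j
    · subst hm
      refine ⟨pathClass k p, fun h a => ?_⟩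
      simp only [relElt, map_sum, map_smul, dropLastHom_ofPath, Path.comp_nil]
      rw [Finset.sum_eq_single h, Finset.sum_eq_single a]
      · rw [dropLast, if_pos rfl, pathClass_cons]
      · intro b _ hb
        rw [dropLast, if_neg, smul_zero]
        intro he
        apply hb
        cases he
        rfl
      · simp
      · intro h' _ hh'
        refine Finset.sum_eq_zero fun b _ => ?_
        rw [dropLast, if_neg, smul_zero]
        intro he
        apply hh'
        cases he
        rfl
      · simp
    · refine ⟨0, fun h a => ?_⟩
      simp only [relElt, map_sum, map_smul, dropLastHom_ofPath, Path.comp_nil, zero_mul, smul_zero]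
      refine Finset.sum_eq_zero fun h' _ => Finset.sum_eq_zero fun b _ => ?_
      rw [dropLast, if_neg, smul_zero]
      intro he
      apply hm
      cases he
      rfl
  | cons q b =>
    refine ⟨0, fun h a => ?_⟩
    simp only [relElt, map_sum, map_smul, dropLastHom_ofPath, Path.comp_cons, zero_mul, smul_zero,
      dropLast]
    split_ifs
    · exact sum_sgn_smul_pathClass p q
    · simp

theorem exists_dropLastHom_of_mem_relSpan {z : PathAlgebra k (Symmetrify V)}
    (hz : z ∈ relSpan k V) (j : Symmetrify V) :
    ∃ y : PreprojectiveAlgebra k V, ∀ (h : Symmetrify V) (a : h ⟶ j),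
      dropLastHom k a z = sgn k a • (y * arrowClass k (reverse a)) := by
  induction hz using Submodule.span_induction with
  | zero => exact ⟨0, by simp⟩
  | add u v _ _ hu hv =>
    obtain ⟨y, hy⟩ := hu
    obtain ⟨y', hy'⟩ := hv
    exact ⟨y + y', fun h a => by rw [map_add, hy, hy', add_mul, smul_add]⟩
  | smul r u _ hu =>
    obtain ⟨y, hy⟩ := hu
    exact ⟨r • y, fun h a => by rw [map_smul, hy, smul_mul_assoc, smul_comm]⟩
  | mem z hz =>
    obtain ⟨i, m, l, p, q, rfl⟩ := hz
    exact exists_dropLastHom_relElt p q j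

/-- Lift the dependence to the path algebra, where it lies in `relSpan`, and read off each
coefficient by removing the last arrow `a`. The trivial path at `h` discards the part of `x h a`
that cannot be followed by `a`. -/
theorem exists_of_sum_mul_arrowClass_eq_zero {j : Symmetrify V}
    (x : ∀ h : Symmetrify V, (h ⟶ j) → PreprojectiveAlgebra k V)
    (hx : ∑ h, ∑ a, x h a * arrowClass k a = 0) :
    ∃ y : PreprojectiveAlgebra k V, ∀ (h : Symmetrify V) (a : h ⟶ j),
      x h a * pathClass k (Path.nil : Path h h) =
        sgn k a • (y * arrowClass k (reverse a)) := by
  classical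
  choose X hX using fun h a => toPreprojective_surjective (x h a)
  have hz : toPreprojective k V
      (∑ h, ∑ a : h ⟶ j, X h a * PathAlgebra.ofPath k ⟨h, j, a.toPath⟩) = 0 := by
    rw [← hx, map_sum]
    refine Finset.sum_congr rfl fun h _ => ?_
    rw [map_sum]
    refine Finset.sum_congr rfl fun a _ => ?_
    rw [map_mul, hX]
    rfl
  obtain ⟨y, hy⟩ := exists_dropLastHom_of_mem_relSpan
    (mem_relSpan_of_toPreprojective_eq_zero hz) j
  refine ⟨y, fun h a => ?_⟩
  rw [← hy h a, map_sum, Finset.sum_eq_single h, map_sum, Finset.sum_eq_single a,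
    dropLastHom_mul_self, hX]
  · intro b _ hb
    refine dropLastHom_mul_of_ne _ _ ?_ _
    intro he
    apply hb
    cases he
    rfl
  · simp
  · intro h' _ hh'
    rw [map_sum]
    refine Finset.sum_eq_zero fun b _ => dropLastHom_mul_of_ne _ _ ?_ _
    intro he
    apply hh'
    cases he
    rfl
  · simp

/-- Exactness of `e_i A_s e_j → ⨁ e_i A_{s+1} e_h → e_i A_{s+2} e_j` in the middle. -/
theorem exists_mem_cell_of_sum_mul_arrowClass_eq_zero {i : Symmetrify V} {s : ℕ}
    {j : Symmetrify V} (x : ∀ h : Symmetrify V, (h ⟶ j) → PreprojectiveAlgebra k V)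
    (hmem : ∀ h a, x h a ∈ cell k i (s + 1) h)
    (hx : ∑ h, ∑ a, x h a * arrowClass k a = 0) :
    ∃ y ∈ cell k i s j, ∀ (h : Symmetrify V) (a : h ⟶ j),
      x h a = sgn k a • (y * arrowClass k (reverse a)) := by
  obtain ⟨y, hy⟩ := exists_of_sum_mul_arrowClass_eq_zero x hx
  refine ⟨cellProj k i s j y, cellProj_mem _ _ _ _, fun h a => ?_⟩
  have h1 := hy h a
  rw [mul_pathClass_nil_of_mem (hmem h a)] at h1
  rw [← cellProj_succ_mul, ← map_smul, ← h1, cellProj_of_mem (hmem h a)]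

/-- In degree zero the coefficients would be multiples of some `y a*`, which has no component of
length zero. -/
theorem eq_zero_of_sum_mul_arrowClass_eq_zero {i : Symmetrify V}
    {j : Symmetrify V} (x : ∀ h : Symmetrify V, (h ⟶ j) → PreprojectiveAlgebra k V)
    (hmem : ∀ h a, x h a ∈ cell k i 0 h)
    (hx : ∑ h, ∑ a, x h a * arrowClass k a = 0) (h : Symmetrify V) (a : h ⟶ j) :
    x h a = 0 := by
  obtain ⟨y, hy⟩ := exists_of_sum_mul_arrowClass_eq_zero x hx
  have h1 := hy h a
  rw [mul_pathClass_nil_of_mem (hmem h a)] at h1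
  rw [← cellProj_of_mem (hmem h a), h1, map_smul, cellProj_zero_mul, smul_zero]

theorem arrowClass_ne_zero {h j : Symmetrify V} (a : h ⟶ j) : arrowClass k a ≠ 0 := by
  classical
  intro h0
  have h1 := eq_zero_of_sum_mul_arrowClass_eq_zero (k := k) (i := h) (j := j)
    (fun h' b => if (⟨h', b⟩ : Σ m : Symmetrify V, m ⟶ j) = ⟨h, a⟩
      then pathClass k (Path.nil : Path h h) else 0)
    (by
      intro h' b
      split_ifs with he
      · cases he
        exact pathClass_mem_cell _ rfl
      · exact zero_mem _)
    (by
      refine Finset.sum_eq_zero fun h' _ => Finset.sum_eq_zero fun b _ => ?_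
      split_ifs with he
      · cases he
        rw [h0, mul_zero]
      · rw [zero_mul]) h a
  rw [if_pos rfl] at h1
  exact pathClass_nil_ne_zero h h1

end Exactness

/-! ### Additivity of the trace -/

section TraceLemmas

variable {k : Type*} [Field k]

/-- Split the short exact sequence by `q` and `r`, write `g = (g ι) r + (g q) p`, and move the
factors around cyclically under the trace. -/
theorem trace_eq_add_of_exact {U W Z : Type*} [AddCommGroup U] [Module k U] [AddCommGroup W]
    [Module k W] [AddCommGroup Z] [Module k Z] [Module.Finite k W] (ι : U →ₗ[k] W) (p : W →ₗ[k] Z)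
    (hι : Function.Injective ι) (hp : Function.Surjective p) (hpι : ∀ u, p (ι u) = 0)
    (hex : ∀ x, p x = 0 → ∃ u, ι u = x) (f : U →ₗ[k] U) (g : W →ₗ[k] W) (h : Z →ₗ[k] Z)
    (hfg : ∀ u, g (ι u) = ι (f u)) (hgh : ∀ x, p (g x) = h (p x)) :
    LinearMap.trace k W g = LinearMap.trace k U f + LinearMap.trace k Z h := by
  have : Module.Finite k U := Module.Finite.of_injective ι hι
  have : Module.Finite k Z := Module.Finite.of_surjective p hp
  obtain ⟨q, hq⟩ := p.exists_rightInverse_of_surjective (LinearMap.range_eq_top.2 hp)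
  have hq' : ∀ z, p (q z) = z := fun z => LinearMap.congr_fun hq z
  let e : U ≃ₗ[k] LinearMap.range ι := LinearEquiv.ofInjective ι hι
  have hr : ∀ x, x - q (p x) ∈ LinearMap.range ι := by
    intro x
    obtain ⟨u, hu⟩ := hex (x - q (p x)) (by rw [map_sub, hq', sub_self])
    exact ⟨u, hu⟩
  let r : W →ₗ[k] U := e.symm.toLinearMap ∘ₗ
    (LinearMap.id - q ∘ₗ p).codRestrict (LinearMap.range ι) hr
  have hιr : ∀ x, ι (r x) = x - q (p x) := by
    intro x
    have : e (r x) = ⟨x - q (p x), hr x⟩ := e.apply_symm_apply _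
    exact congrArg Subtype.val this
  have hrι : ∀ u, r (ι u) = u := by
    intro u
    apply hι
    rw [hιr, hpι, map_zero, sub_zero]
  have hg : g = (g ∘ₗ ι) ∘ₗ r + (g ∘ₗ q) ∘ₗ p := by
    ext x
    simp [hιr]
  have h1 : r ∘ₗ (g ∘ₗ ι) = f := by
    ext u
    simp [hfg, hrι]
  have h2 : p ∘ₗ (g ∘ₗ q) = h := by
    ext z
    simp [hgh, hq']
  conv_lhs => rw [hg]
  rw [map_add, LinearMap.trace_comp_comm', h1, LinearMap.trace_comp_comm' p, h2]

theorem trace_eq_sum_of_pi {ι : Type*} [Fintype ι] {M : ι → Type*} [∀ a, AddCommGroup (M a)]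
    [∀ a, Module k (M a)] [∀ a, Module.Finite k (M a)] (f : (∀ a, M a) →ₗ[k] (∀ a, M a))
    (φ : ∀ a, M a →ₗ[k] M a) (hf : ∀ x a, f x a = φ a (x a)) :
    LinearMap.trace k (∀ a, M a) f = ∑ a, LinearMap.trace k (M a) (φ a) := by
  classical
  have h1 : f = ∑ a, (f ∘ₗ LinearMap.single k M a) ∘ₗ LinearMap.proj a := by
    refine LinearMap.ext fun x => ?_
    simp only [LinearMap.sum_apply, LinearMap.comp_apply, LinearMap.proj_apply, ← map_sum]
    congr 1
    exact (Finset.univ_sum_single x).symm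
  rw [h1, map_sum]
  refine Finset.sum_congr rfl fun a _ => ?_
  rw [LinearMap.trace_comp_comm']
  congr 1
  ext x
  simp [hf]

end TraceLemmas

/-! ### The complex at a vertex, and rigidity of its compatible endomorphisms -/

section Complex

variable {k : Type*} {V : Type*} [Field k] [Fintype V] [Quiver V] [∀ a b : V, Fintype (a ⟶ b)]

/-- The arrows of the double that end at `j`. -/
abbrev InArrow (j : Symmetrify V) := Σ h : Symmetrify V, h ⟶ j

variable (k) in
/-- Right multiplication by an arrow. -/
def mulArrow (i : Symmetrify V) (s : ℕ) {h j : Symmetrify V} (a : h ⟶ j) :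
    cell k i s h →ₗ[k] cell k i (s + 1) j :=
  (LinearMap.mulRight k (arrowClass k a)).restrict fun _ hx => mul_arrowClass_mem hx a

theorem coe_mulArrow {i : Symmetrify V} {s : ℕ} {h j : Symmetrify V} (a : h ⟶ j)
    (x : cell k i s h) : (mulArrow k i s a x : PreprojectiveAlgebra k V) =
      x * arrowClass k a := rfl

variable (k) in
/-- The map `(x_a) ↦ ∑ x_a a`, over the arrows `a` ending at `j`. -/
def gather (i : Symmetrify V) (s : ℕ) (j : Symmetrify V) :
    (∀ a : InArrow j, cell k i s a.1) →ₗ[k] cell k i (s + 1) j :=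
  ∑ a : InArrow j, mulArrow k i s a.2 ∘ₗ LinearMap.proj a

theorem gather_apply {i : Symmetrify V} {s : ℕ} {j : Symmetrify V}
    (x : ∀ a : InArrow j, cell k i s a.1) :
    gather k i s j x = ∑ a : InArrow j, mulArrow k i s a.2 (x a) := by
  simp [gather]

variable (k) in
/-- The map `x ↦ (± x a*)_a`, over the arrows `a` ending at `j`. -/
def spread (i : Symmetrify V) (s : ℕ) (j : Symmetrify V) :
    cell k i s j →ₗ[k] ∀ a : InArrow j, cell k i (s + 1) a.1 :=
  LinearMap.pi fun a => sgn k a.2 • mulArrow k i s (reverse a.2)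

theorem spread_apply {i : Symmetrify V} {s : ℕ} {j : Symmetrify V} (x : cell k i s j)
    (a : InArrow j) : spread k i s j x a = sgn k a.2 • mulArrow k i s (reverse a.2) x := rfl

theorem coe_gather {i : Symmetrify V} {s : ℕ} {j : Symmetrify V}
    (x : ∀ a : InArrow j, cell k i s a.1) :
    (gather k i s j x : PreprojectiveAlgebra k V) =
      ∑ h, ∑ a : h ⟶ j, (x ⟨h, a⟩ : PreprojectiveAlgebra k V) * arrowClass k a := by
  rw [gather_apply, Submodule.coe_sum, Fintype.sum_sigma]
  rfl

theorem gather_surjective (i : Symmetrify V) (s : ℕ) (j : Symmetrify V) :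
    Function.Surjective (gather k i s j) := by
  classical
  rw [← LinearMap.range_eq_top, eq_top_iff]
  rintro ⟨x, hx⟩ -
  have key : cell k i (s + 1) j ≤
      (LinearMap.range (gather k i s j)).map (cell k i (s + 1) j).subtype := by
    refine Submodule.span_le.2 ?_
    rintro _ ⟨p, hp, rfl⟩
    cases p with
    | nil => simp at hp
    | cons p a =>
      rename_i h
      have hp' : p.length = s := by simpa using hp
      refine ⟨mulArrow k i s a ⟨pathClass k p, pathClass_mem_cell p hp'⟩,
        ⟨Pi.single (M := fun a : InArrow j => cell k i s a.1) ⟨h, a⟩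
          ⟨pathClass k p, pathClass_mem_cell p hp'⟩, ?_⟩, ?_⟩
      · rw [gather_apply, Finset.sum_eq_single ⟨h, a⟩]
        · rw [Pi.single_eq_same]
        · intro b _ hb
          rw [Pi.single_eq_of_ne hb, map_zero]
        · simp
      · exact (pathClass_cons p a).symm
  obtain ⟨y, hy, hyx⟩ := key hx
  have : y = ⟨x, hx⟩ := Subtype.ext hyx
  exact this ▸ hy

theorem gather_spread {i : Symmetrify V} {s : ℕ} {j : Symmetrify V} (x : cell k i s j) :
    gather k i (s + 1) j (spread k i s j x) = 0 := by
  apply Subtype.ext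
  rw [coe_gather]
  simpa [spread_apply, coe_mulArrow] using sum_sgn_smul_mul x.2

theorem exists_spread_eq {i : Symmetrify V} {s : ℕ} {j : Symmetrify V}
    (x : ∀ a : InArrow j, cell k i (s + 1) a.1) (hx : gather k i (s + 1) j x = 0) :
    ∃ y, spread k i s j y = x := by
  obtain ⟨y, hy, hyx⟩ := exists_mem_cell_of_sum_mul_arrowClass_eq_zero
    (fun h (a : h ⟶ j) => (x ⟨h, a⟩ : PreprojectiveAlgebra k V)) (fun h a => (x ⟨h, a⟩).2)
    (by rw [← coe_gather, hx, Submodule.coe_zero])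
  refine ⟨⟨y, hy⟩, funext fun a => Subtype.ext ?_⟩
  exact (hyx a.1 a.2).symm

theorem gather_zero_injective (i j : Symmetrify V) : Function.Injective (gather k i 0 j) := by
  rw [injective_iff_map_eq_zero]
  intro x hx
  refine funext fun a => Subtype.ext ?_
  exact eq_zero_of_sum_mul_arrowClass_eq_zero
    (fun h (a : h ⟶ j) => (x ⟨h, a⟩ : PreprojectiveAlgebra k V)) (fun h a => (x ⟨h, a⟩).2)
    (by rw [← coe_gather, hx, Submodule.coe_zero]) a.1 a.2

theorem cell_zero_self (i : Symmetrify V) :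
    cell k i 0 i = Submodule.span k {pathClass k (Path.nil : Path i i)} := by
  rw [cell]
  congr 1
  ext x
  constructor
  · rintro ⟨p, hp, rfl⟩
    cases p with
    | nil => rfl
    | cons p a => simp at hp
  · rintro rfl
    exact ⟨Path.nil, rfl, rfl⟩

theorem cell_zero_of_ne {i j : Symmetrify V} (h : i ≠ j) : cell k i 0 j = ⊥ := by
  rw [cell, Submodule.span_eq_bot]
  rintro _ ⟨p, hp, rfl⟩
  exact absurd (Path.eq_of_length_zero p hp) h

instance cell_finite (i : Symmetrify V) (s : ℕ) (j : Symmetrify V) :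
    Module.Finite k (cell k i s j) := by
  induction s generalizing j with
  | zero =>
    by_cases h : i = j
    · subst h
      rw [cell_zero_self]
      infer_instance
    · rw [cell_zero_of_ne h]
      infer_instance
  | succ s ih => exact Module.Finite.of_surjective _ (gather_surjective i s j)

/-- Two linear endomorphisms of consecutive degrees, compatible with right multiplication by
arrows, are multiplication by a common scalar. -/
theorem exists_smul_of_comm (i : Symmetrify V) (s : ℕ)
    (hinj : ∀ s' < s, ∀ j, Function.Injective (spread k i s' j))
    (φ : ∀ j, cell k i s j →ₗ[k] cell k i s j)
    (ψ : ∀ j, cell k i (s + 1) j →ₗ[k] cell k i (s + 1) j)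
    (h : ∀ (j l : Symmetrify V) (a : j ⟶ l) (x : cell k i s j),
      ψ l (mulArrow k i s a x) = mulArrow k i s a (φ j x)) :
    ∃ c : k, (∀ j x, φ j x = c • x) ∧ ∀ j x, ψ j x = c • x := by
  suffices hs : ∃ c : k, ∀ j x, φ j x = c • x by
    obtain ⟨c, hc⟩ := hs
    refine ⟨c, hc, fun j x => ?_⟩
    obtain ⟨y, rfl⟩ := gather_surjective i s j x
    simp only [gather_apply, map_sum, h, hc, map_smul, Finset.smul_sum]
  induction s with
  | zero =>
    have hn : pathClass k (Path.nil : Path i i) ∈ cell k i 0 i := pathClass_mem_cell _ rfl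
    have hspan : ∀ x : cell k i 0 i, ∃ r : k, x = r • ⟨pathClass k Path.nil, hn⟩ := by
      rintro ⟨x, hx⟩
      have hx' := hx
      rw [cell_zero_self, Submodule.mem_span_singleton] at hx'
      obtain ⟨r, rfl⟩ := hx'
      exact ⟨r, rfl⟩
    obtain ⟨c, hc⟩ := hspan (φ i ⟨pathClass k Path.nil, hn⟩)
    refine ⟨c, fun j x => ?_⟩
    by_cases hij : i = j
    · subst hij
      obtain ⟨r, rfl⟩ := hspan x
      rw [map_smul, hc, smul_comm]
    · have : x = 0 := by
        apply Subtype.ext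
        exact (Submodule.mem_bot k).1 ((cell_zero_of_ne (k := k) hij).le x.2)
      rw [this, map_zero, smul_zero]
  | succ s ih =>
    -- Descend one degree: `φ` preserves the kernel of `gather` because `ψ` is compatible with it.
    -- That kernel is the image of the injective `spread`, so `φ` induces `χ` in degree `s`.
    have hex : ∀ j, ∃ χ : cell k i s j →ₗ[k] cell k i s j, ∀ y a,
        spread k i s j (χ y) a = φ a.1 (spread k i s j y a) := by
      intro j
      obtain ⟨r, hr⟩ := (spread k i s j).exists_leftInverse_of_injective
        (LinearMap.ker_eq_bot.2 (hinj s (Nat.lt_succ_self s) j))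
      have hr' : ∀ y, r (spread k i s j y) = y := fun y => LinearMap.congr_fun hr y
      let Φ : (∀ a : InArrow j, cell k i (s + 1) a.1) →ₗ[k]
          ∀ a : InArrow j, cell k i (s + 1) a.1 :=
        LinearMap.pi fun a => φ a.1 ∘ₗ LinearMap.proj a
      refine ⟨r ∘ₗ Φ ∘ₗ spread k i s j, fun y a => ?_⟩
      obtain ⟨y', hy'⟩ := exists_spread_eq (Φ (spread k i s j y)) (by
        have h0 : ψ j (gather k i (s + 1) j (spread k i s j y)) = 0 := by
          rw [gather_spread, map_zero]
        rw [gather_apply, map_sum] at h0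
        rw [gather_apply, ← h0]
        exact Finset.sum_congr rfl fun a _ => (h _ _ _ _).symm)
      have : r (Φ (spread k i s j y)) = y' := by rw [← hy', hr']
      simp only [LinearMap.comp_apply, this, hy']
      rfl
    choose χ hχ using hex
    obtain ⟨c, hc⟩ := ih (fun s' hs' => hinj s' (hs'.trans (Nat.lt_succ_self s))) χ φ (by
      intro j l a x
      have := hχ j x ⟨l, reverse a⟩
      simp only [spread_apply, map_smul, reverse_reverse] at this
      exact (smul_right_injective _ (sgn_ne_zero k (reverse a)) this).symm)
    -- The scalar found for `χ` climbs back up, since every element of positive degree is a sum of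
    -- products with arrows.
    refine ⟨c, fun j x => ?_⟩
    obtain ⟨y, rfl⟩ := gather_surjective i s j x
    simp only [gather_apply, map_sum, Finset.smul_sum]
    refine Finset.sum_congr rfl fun a _ => ?_
    have := hχ a.1 (y a) ⟨j, reverse a.2⟩
    simp only [spread_apply, map_smul, reverse_reverse, hc] at this
    have h2 := smul_right_injective _ (sgn_ne_zero k (reverse a.2)) this
    exact h2.symm

/-- If all arrows kill `x ≠ 0`, the map `y ↦ ξ(y) x` in degree `s` is compatible with zero in degree
`s + 1`. By rigidity both are one scalar: it equals `ξ(x) ≠ 0`, yet it kills a nonzero `z`. -/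
theorem spread_injective_of_exists_ne_zero (i : Symmetrify V) (s : ℕ)
    (hinj : ∀ s' < s, ∀ j, Function.Injective (spread k i s' j))
    (hne : ∃ j, ∃ x : cell k i (s + 1) j, x ≠ 0) (j : Symmetrify V) :
    Function.Injective (spread k i s j) := by
  classical
  rw [injective_iff_map_eq_zero]
  intro x hx
  by_contra hx0
  obtain ⟨ξ, hξ⟩ := Module.Projective.exists_dual_ne_zero k hx0
  obtain ⟨z₀, z, hz⟩ := hne
  have hmul : ∀ (l : Symmetrify V) (a : j ⟶ l), mulArrow k i s a x = 0 := by
    intro l a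
    have := congrFun hx ⟨l, reverse a⟩
    rw [spread_apply, reverse_reverse] at this
    exact (smul_eq_zero.1 this).resolve_left (sgn_ne_zero k _)
  obtain ⟨c, hc, hc'⟩ := exists_smul_of_comm i s hinj
    (Function.update (fun _ => 0) j (ξ.smulRight x)) (fun _ => 0) (by
      intro j' l a y
      by_cases hj : j' = j
      · subst hj
        rw [Function.update_self, LinearMap.smulRight_apply, map_smul, hmul, smul_zero,
          LinearMap.zero_apply]
      · rw [Function.update_of_ne hj, LinearMap.zero_apply, LinearMap.zero_apply, map_zero])
  have h1 := hc j x
  rw [Function.update_self, LinearMap.smulRight_apply] at h1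
  have h2 : ξ x = c := smul_left_injective _ hx0 h1
  have h3 := hc' z₀ z
  rw [LinearMap.zero_apply] at h3
  exact (smul_eq_zero.1 h3.symm).elim (fun h => hξ (h2.trans h)) hz

end Complex

/-! ### The trace recurrence and injectivity of `spread` -/

section Trace

variable {k : Type*} {V : Type*} [Field k] [Fintype V] [Quiver V] [∀ a b : V, Fintype (a ⟶ b)]

/-- A linear endomorphism that fixes the trivial paths and multiplies the class of a path by the
product of the weights of its arrows. -/
structure IsScaling (w : ∀ {h j : Symmetrify V}, (h ⟶ j) → k)
    (g : PreprojectiveAlgebra k V →ₗ[k] PreprojectiveAlgebra k V) : Prop where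
  map_nil : ∀ j : Symmetrify V, g (pathClass k (Path.nil : Path j j)) = pathClass k (Path.nil : Path j j)
  map_mul_arrow : ∀ (x : PreprojectiveAlgebra k V) {h j : Symmetrify V} (a : h ⟶ j),
    g (x * arrowClass k a) = w a • (g x * arrowClass k a)

theorem isScaling_id : IsScaling (k := k) (V := V) (fun _ => 1) LinearMap.id :=
  ⟨fun _ => rfl, fun _ _ => by simp⟩

variable {w : ∀ {h j : Symmetrify V}, (h ⟶ j) → k}
  {g : PreprojectiveAlgebra k V →ₗ[k] PreprojectiveAlgebra k V}

theorem IsScaling.map_pathClass_mem (hg : IsScaling w g) {i j : Symmetrify V} (p : Path i j) :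
    g (pathClass k p) ∈ cell k i p.length j := by
  induction p with
  | nil => rw [hg.map_nil]; exact pathClass_mem_cell _ rfl
  | cons p a ih =>
    rw [pathClass_cons, hg.map_mul_arrow]
    exact Submodule.smul_mem _ _ (mul_arrowClass_mem ih a)

theorem IsScaling.mapsTo_cell (hg : IsScaling w g) (i : Symmetrify V) (s : ℕ) (j : Symmetrify V) :
    ∀ x ∈ cell k i s j, g x ∈ cell k i s j := by
  intro x hx
  induction hx using Submodule.span_induction with
  | zero => simp
  | add u v _ _ hu hv => rw [map_add]; exact add_mem hu hv
  | smul r u _ hu => rw [map_smul]; exact Submodule.smul_mem _ _ hu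
  | mem x hx =>
    obtain ⟨p, rfl, rfl⟩ := hx
    exact hg.map_pathClass_mem p

/-- The trace of a scaling map on `e_i A_s e_j`. -/
def cellTrace (hg : IsScaling w g) (i : Symmetrify V) (s : ℕ) (j : Symmetrify V) : k :=
  LinearMap.trace k (cell k i s j) (g.restrict (hg.mapsTo_cell i s j))

theorem IsScaling.restrict_mulArrow (hg : IsScaling w g) {i : Symmetrify V} {s : ℕ}
    {h j : Symmetrify V} (a : h ⟶ j) (x : cell k i s h) :
    g.restrict (hg.mapsTo_cell i (s + 1) j) (mulArrow k i s a x) =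
      w a • mulArrow k i s a (g.restrict (hg.mapsTo_cell i s h) x) :=
  Subtype.ext (hg.map_mul_arrow _ a)

theorem cellTrace_zero_self (hg : IsScaling w g) (i : Symmetrify V) : cellTrace hg i 0 i = 1 := by
  have h1 : g.restrict (hg.mapsTo_cell i 0 i) = LinearMap.id := by
    ext ⟨x, hx⟩
    have hx' := hx
    rw [cell_zero_self, Submodule.mem_span_singleton] at hx'
    obtain ⟨r, rfl⟩ := hx'
    simp [hg.map_nil]
  rw [cellTrace, h1, LinearMap.trace_id, cell_zero_self,
    finrank_span_singleton (pathClass_nil_ne_zero i), Nat.cast_one]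

theorem cellTrace_zero_of_ne (hg : IsScaling w g) {i j : Symmetrify V} (h : i ≠ j) :
    cellTrace hg i 0 j = 0 := by
  have h1 : g.restrict (hg.mapsTo_cell i 0 j) = 0 := by
    ext x
    have hx : (x : PreprojectiveAlgebra k V) = 0 :=
      (Submodule.mem_bot k).1 ((cell_zero_of_ne (k := k) h).le x.2)
    simp [hx]
  rw [cellTrace, h1, map_zero]

theorem trace_pi_smul_restrict (hg : IsScaling w g) (i : Symmetrify V) (s : ℕ)
    (j : Symmetrify V) :
    LinearMap.trace k (∀ a : InArrow j, cell k i s a.1)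
      (LinearMap.pi fun a : InArrow j =>
        w a.2 • (g.restrict (hg.mapsTo_cell i s a.1)) ∘ₗ LinearMap.proj a) =
      ∑ h, ∑ a : h ⟶ j, w a * cellTrace hg i s h := by
  rw [trace_eq_sum_of_pi _ (fun a : InArrow j => w a.2 • g.restrict (hg.mapsTo_cell i s a.1))
    (fun _ _ => rfl), Fintype.sum_sigma]
  simp [cellTrace]

theorem gather_pi_smul_restrict (hg : IsScaling w g) {i : Symmetrify V} {s : ℕ}
    {j : Symmetrify V} (x : ∀ a : InArrow j, cell k i s a.1) :
    gather k i s j ((LinearMap.pi fun a : InArrow j =>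
        w a.2 • (g.restrict (hg.mapsTo_cell i s a.1)) ∘ₗ LinearMap.proj a) x) =
      g.restrict (hg.mapsTo_cell i (s + 1) j) (gather k i s j x) := by
  rw [gather_apply, gather_apply, map_sum]
  refine Finset.sum_congr rfl fun a _ => ?_
  rw [hg.restrict_mulArrow]
  simp

theorem cellTrace_one (hg : IsScaling w g) (i j : Symmetrify V) :
    cellTrace hg i 1 j = ∑ h, ∑ a : h ⟶ j, w a * cellTrace hg i 0 h := by
  rw [← trace_pi_smul_restrict hg i 0 j, trace_eq_add_of_exact
    -- The zero space stands for the missing degree `-1`.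
    (0 : PUnit.{1} →ₗ[k] ∀ a : InArrow j, cell k i 0 a.1) (gather k i 0 j)
    (Function.injective_of_subsingleton _) (gather_surjective i 0 j) (by simp)
    (fun x hx => ⟨0, by rw [map_zero, gather_zero_injective i j (hx.trans (map_zero _).symm)]⟩)
    0 _ (g.restrict (hg.mapsTo_cell i 1 j)) (by simp) (gather_pi_smul_restrict hg), map_zero,
    zero_add]
  rfl

/-- The component `x ↦ ± x a*` picks up `w a*` from `g` and `w a` from the twist of the middle term,
so the left end carries `lam • g`. -/
theorem cellTrace_add_two (hg : IsScaling w g) {lam : k}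
    (hw : ∀ {h j : Symmetrify V} (a : h ⟶ j), w a * w (reverse a) = lam)
    (i : Symmetrify V) (s : ℕ) (j : Symmetrify V)
    (hinj : Function.Injective (spread k i s j)) :
    cellTrace hg i (s + 2) j =
      ∑ h, ∑ a : h ⟶ j, w a * cellTrace hg i (s + 1) h - lam * cellTrace hg i s j := by
  rw [← trace_pi_smul_restrict hg i (s + 1) j, trace_eq_add_of_exact
    (spread k i s j) (gather k i (s + 1) j) hinj (gather_surjective i (s + 1) j)
    gather_spread exists_spread_eq (lam • g.restrict (hg.mapsTo_cell i s j)) _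
    (g.restrict (hg.mapsTo_cell i (s + 2) j)) ?_ (gather_pi_smul_restrict hg), map_smul,
    smul_eq_mul]
  · simp [cellTrace]
  · intro x
    refine funext fun a => ?_
    simp only [LinearMap.pi_apply, LinearMap.smul_apply, LinearMap.comp_apply,
      LinearMap.proj_apply, spread_apply, map_smul, hg.restrict_mulArrow, ← hw a.2]
    module

/-- If the underlying graph has a positive function `δ` with `∑ δ = 2 δ` over the neighbours of
each vertex, then no nonzero element of `e_i A_s e_j` is killed by all arrows. -/
theorem spread_injective [CharZero k] (δ : Symmetrify V → ℕ) (hpos : ∀ j, 0 < δ j)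
    (hδ : ∀ h : Symmetrify V, ∑ j, ∑ _a : h ⟶ j, δ j = 2 * δ h)
    (i : Symmetrify V) (s : ℕ) : ∀ j, Function.Injective (spread k i s j) := by
  induction s using Nat.strong_induction_on with
  | _ s ih =>
    -- The trace of the identity is a dimension, read in `k`. Weighting by `δ`, an eigenvector of
    -- the adjacency matrix for the eigenvalue 2, turns the vector recurrence into a scalar one.
    let D : ℕ → k := fun n => ∑ j, (δ j : k) * cellTrace (isScaling_id (k := k) (V := V)) i n j
    have hsum : ∀ f : Symmetrify V → k,
        ∑ j, (δ j : k) * ∑ h, ∑ _a : h ⟶ j, 1 * f h = 2 * ∑ h, (δ h : k) * f h := by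
      intro f
      have h1 : ∀ h : Symmetrify V, ∑ j, ∑ _a : h ⟶ j, (δ j : k) = 2 * δ h := by
        intro h
        exact_mod_cast congrArg (Nat.cast : ℕ → k) (hδ h)
      simp only [Finset.mul_sum, one_mul]
      rw [Finset.sum_comm]
      refine Finset.sum_congr rfl fun h _ => ?_
      rw [← mul_assoc, ← h1]
      simp only [Finset.sum_mul]
    have hD0 : D 0 = δ i := by
      simp only [D]
      rw [Finset.sum_eq_single i, cellTrace_zero_self, mul_one]
      · intro j _ hj
        rw [cellTrace_zero_of_ne _ hj.symm, mul_zero]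
      · simp
    have hD1 : D 1 = 2 * D 0 := by
      simp only [D, cellTrace_one]
      exact hsum _
    have hD2 : ∀ n < s, D (n + 2) = 2 * D (n + 1) - D n := by
      intro n hn
      simp only [D]
      rw [← hsum, ← Finset.sum_sub_distrib]
      refine Finset.sum_congr rfl fun j _ => ?_
      rw [cellTrace_add_two isScaling_id (lam := 1) (by simp) i n j (ih n hn j), one_mul, mul_sub]
    -- The recurrence is known for `n < s` only, which still reaches `D (s + 1)`; that value is
    -- nonzero in characteristic zero.
    have hD : ∀ n ≤ s, D n = (n + 1) * δ i ∧ D (n + 1) = (n + 2) * δ i := by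
      intro n
      induction n with
      | zero =>
        intro _
        rw [hD1, hD0]
        simp
      | succ n ihn =>
        intro hn
        obtain ⟨h1, h2⟩ := ihn (by omega)
        refine ⟨by rw [h2]; push_cast; ring, ?_⟩
        rw [hD2 n (by omega), h1, h2]
        push_cast
        ring
    refine spread_injective_of_exists_ne_zero i s ih ?_
    by_contra hcon
    push Not at hcon
    have h0 : D (s + 1) = 0 := by
      refine Finset.sum_eq_zero fun j _ => ?_
      have : (LinearMap.id.restrict ((isScaling_id (k := k) (V := V)).mapsTo_cell i (s + 1) j)) =
          0 := LinearMap.ext fun x => (hcon j x).symm ▸ map_zero _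
      rw [cellTrace, this, map_zero, mul_zero]
    rw [(hD s le_rfl).2] at h0
    have h3 : (((s + 2) * δ i : ℕ) : k) = 0 := by
      push_cast
      exact h0
    rw [Nat.cast_eq_zero] at h3
    exact (Nat.mul_pos (Nat.succ_pos (s + 1)) (hpos i)).ne' h3

end Trace

/-! ### The constant `λ` and the weights of paths -/

section ArrowWeights

variable {k : Type*} {V : Type*} [Field k] [Fintype V] [Quiver V] [∀ a b : V, Fintype (a ⟶ b)]
  {w : ∀ {h j : Symmetrify V}, (h ⟶ j) → k}
  {g : PreprojectiveAlgebra k V →ₗ[k] PreprojectiveAlgebra k V}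

/-- The weights `w a w a*` agree for all arrows `a` that end at a given vertex. -/
theorem IsScaling.exists_mul_reverse_eq (hg : IsScaling w g) (j : Symmetrify V) :
    ∃ η : k, ∀ {h : Symmetrify V} (a : h ⟶ j), w a * w (reverse a) = η := by
  have hnil : pathClass k (Path.nil : Path j j) ∈ cell k j 0 j := pathClass_mem_cell _ rfl
  -- Applying `g` to the relation at `j` gives a second relation, with coefficients `± w a w a*`. By
  -- exactness in degree two it comes from an element of `e_j A_0 e_j`, hence is a multiple `η` of
  -- the first.
  have hr := congrArg g (sum_sgn_smul_mul hnil)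
  simp only [map_sum, map_smul, map_zero, hg.map_mul_arrow, hg.map_nil] at hr
  obtain ⟨y, hy, hyx⟩ := exists_mem_cell_of_sum_mul_arrowClass_eq_zero (i := j) (s := 0)
    (fun h (a : h ⟶ j) => (sgn k a * (w a * w (reverse a))) •
      (pathClass k (Path.nil : Path j j) * arrowClass k (reverse a)))
    (fun h a => Submodule.smul_mem _ _ (mul_arrowClass_mem hnil _)) (by
      rw [← hr]
      refine Finset.sum_congr rfl fun h _ => Finset.sum_congr rfl fun a _ => ?_
      simp only [smul_mul_assoc, smul_smul])
  rw [cell_zero_self, Submodule.mem_span_singleton] at hy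
  obtain ⟨η, rfl⟩ := hy
  refine ⟨η, fun {h} a => ?_⟩
  have h1 := hyx h a
  have hne : pathClass k (Path.nil : Path j j) * arrowClass k (reverse a) ≠ 0 := by
    rw [arrowClass, pathClass_mul, Path.nil_comp]
    exact arrowClass_ne_zero _
  rw [smul_mul_assoc, smul_smul] at h1
  exact mul_left_cancel₀ (sgn_ne_zero k a) (smul_left_injective _ hne h1)

/-- An arrow and its reverse have the same product of weights, so the constants at its two ends
agree; `hconn`, which expresses connectedness, makes them all equal. -/
theorem IsScaling.exists_forall_mul_reverse_eq (hg : IsScaling w g)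
    (hw : ∀ {h j : Symmetrify V} (a : h ⟶ j), w a ≠ 0)
    (hconn : ∀ f : Symmetrify V → k,
      (∀ {h j : Symmetrify V} (_ : h ⟶ j), f h = f j) → ∀ h j, f h = f j) :
    ∃ lam : k, lam ≠ 0 ∧ ∀ {h j : Symmetrify V} (a : h ⟶ j), w a * w (reverse a) = lam := by
  choose η hη using hg.exists_mul_reverse_eq
  have hconst := hconn η (by
    intro h j a
    rw [← hη j a, ← hη h (reverse a), reverse_reverse, mul_comm])
  by_cases hex : ∃ (h j : Symmetrify V), Nonempty (h ⟶ j)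
  · obtain ⟨h, j, ⟨a⟩⟩ := hex
    refine ⟨η j, ?_, fun {h' j'} b => by rw [hη j' b, hconst]⟩
    rw [← hη j a]
    exact mul_ne_zero (hw a) (hw _)
  · exact ⟨1, one_ne_zero, fun {h j} a => absurd ⟨h, j, ⟨a⟩⟩ hex⟩

/-- The product of the weights of the arrows of a path. -/
def pathWeight (w : ∀ {h j : Symmetrify V}, (h ⟶ j) → k) {i : Symmetrify V} :
    ∀ {j : Symmetrify V}, Path i j → k
  | _, Path.nil => 1
  | _, Path.cons p a => pathWeight w p * w a

omit [Fintype V] [∀ a b : V, Fintype (a ⟶ b)] in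
theorem pathWeight_comp {i j l : Symmetrify V} (p : Path i j) (q : Path j l) :
    pathWeight w (p.comp q) = pathWeight w p * pathWeight w q := by
  induction q with
  | nil => simp [pathWeight]
  | cons q a ih => rw [Path.comp_cons, pathWeight, ih, pathWeight, mul_assoc]

theorem pathWeight_reverse {lam : k}
    (hw : ∀ {h j : Symmetrify V} (a : h ⟶ j), w a * w (reverse a) = lam)
    {i j : Symmetrify V} (p : Path i j) :
    pathWeight w p * pathWeight w p.reverse = lam ^ p.length := by
  induction p with
  | nil => simp [pathWeight]
  | cons p a ih =>
    rw [Path.reverse, pathWeight_comp, Path.length_cons, pow_succ, ← ih, ← hw a]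
    simp only [pathWeight, Hom.toPath, one_mul]
    ring

theorem IsScaling.map_pathClass (hg : IsScaling w g) {i j : Symmetrify V} (p : Path i j) :
    g (pathClass k p) = pathWeight w p • pathClass k p := by
  induction p with
  | nil => rw [hg.map_nil, pathWeight, one_smul]
  | cons p a ih =>
    rw [pathClass_cons, hg.map_mul_arrow, ih, pathWeight, smul_mul_assoc, smul_smul, mul_comm]

omit [Fintype V] [∀ a b : V, Fintype (a ⟶ b)] in
theorem length_reverse {i j : Symmetrify V} (p : Path i j) : p.reverse.length = p.length := by
  induction p with
  | nil => rfl
  | cons p a ih => rw [Path.reverse, Path.length_comp, ih, Path.length_cons]; simp [add_comm]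

end ArrowWeights

/-! ### Path reversal, exchanging `A e_i` and `e_i A` -/

section Reversal

variable {k : Type*} {V : Type*} [Field k] [Fintype V] [Quiver V] [∀ a b : V, Fintype (a ⟶ b)]

-- Each product `a* a` in a relation is its own reverse, so reversal respects the relations with
-- their signs unchanged.
variable (k V) in
theorem exists_reversal :
    ∃ f : PreprojectiveAlgebra k V →ₗ[k] PreprojectiveAlgebra k V,
      ∀ {i j : Symmetrify V} (p : Path i j), f (pathClass k p) = pathClass k p.reverse := by
  refine exists_linearMap_pathClass (fun p => pathClass k p.reverse) fun p q => ?_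
  rw [← sum_sgn_smul_pathClass q.reverse p.reverse]
  refine Finset.sum_congr rfl fun h _ => Finset.sum_congr rfl fun a _ => ?_
  congr 2
  rw [Path.reverse_comp, Path.reverse, Path.reverse, reverse_reverse, ← Path.comp_assoc,
    ← Path.comp_assoc]
  rfl

variable (k V) in
/-- The linear involution of the preprojective algebra that reverses paths. -/
def reversal : PreprojectiveAlgebra k V ≃ₗ[k] PreprojectiveAlgebra k V :=
  LinearEquiv.ofInvolutive (exists_reversal k V).choose (by
    have h : (exists_reversal k V).choose ∘ₗ (exists_reversal k V).choose = LinearMap.id :=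
      linearMap_ext_pathClass fun p => by
        rw [LinearMap.comp_apply, (exists_reversal k V).choose_spec,
          (exists_reversal k V).choose_spec, Path.reverse_reverse, LinearMap.id_apply]
    exact LinearMap.congr_fun h)

theorem reversal_pathClass {i j : Symmetrify V} (p : Path i j) :
    reversal k V (pathClass k p) = pathClass k p.reverse :=
  (exists_reversal k V).choose_spec p

theorem pathClass_nil_eq_idem (i : Symmetrify V) :
    pathClass k (Path.nil : Path i i) = idem k (V := V) i := rfl

theorem rightPiece_eq_span (i : Symmetrify V) (s : ℕ) :
    rightPiece k (V := V) i s = Submodule.span k {x | ∃ (j : Symmetrify V)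
      (p : Path i j), p.length = s ∧ x = pathClass k p} := by
  refine le_antisymm ?_ ?_
  · change (piece k V s).map (LinearMap.mulLeft k (pathClass k (Path.nil : Path i i))) ≤ _
    rw [piece, Submodule.map_span, Submodule.span_le]
    rintro _ ⟨_, ⟨⟨a, b, p⟩, hp, rfl⟩, rfl⟩
    rw [LinearMap.mulLeft_apply]
    change _ * pathClass k p ∈ _
    by_cases h : i = a
    · subst h
      rw [pathClass_mul, Path.nil_comp]
      exact Submodule.subset_span ⟨b, p, hp, rfl⟩
    · rw [pathClass_mul_of_ne _ _ h]
      exact zero_mem _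
  · rw [Submodule.span_le]
    rintro _ ⟨j, p, hp, rfl⟩
    refine ⟨pathClass k p, Submodule.subset_span ⟨⟨i, j, p⟩, hp, rfl⟩, ?_⟩
    rw [LinearMap.mulLeft_apply, ← pathClass_nil_eq_idem, pathClass_mul, Path.nil_comp]

theorem leftPiece_eq_span (i : Symmetrify V) (s : ℕ) :
    leftPiece k (V := V) i s = Submodule.span k {x | ∃ (j : Symmetrify V)
      (p : Path j i), p.length = s ∧ x = pathClass k p} := by
  refine le_antisymm ?_ ?_
  · change (piece k V s).map (LinearMap.mulRight k (pathClass k (Path.nil : Path i i))) ≤ _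
    rw [piece, Submodule.map_span, Submodule.span_le]
    rintro _ ⟨_, ⟨⟨a, b, p⟩, hp, rfl⟩, rfl⟩
    rw [LinearMap.mulRight_apply]
    change pathClass k p * _ ∈ _
    by_cases h : b = i
    · subst h
      rw [pathClass_mul, Path.comp_nil]
      exact Submodule.subset_span ⟨a, p, hp, rfl⟩
    · rw [pathClass_mul_of_ne _ _ h]
      exact zero_mem _
  · rw [Submodule.span_le]
    rintro _ ⟨j, p, hp, rfl⟩
    refine ⟨pathClass k p, Submodule.subset_span ⟨⟨j, i, p⟩, hp, rfl⟩, ?_⟩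
    rw [LinearMap.mulRight_apply, ← pathClass_nil_eq_idem, pathClass_mul, Path.comp_nil]

theorem map_reversal_leftPiece (i : Symmetrify V) (s : ℕ) :
    (leftPiece k (V := V) i s).map (reversal k V : _ →ₗ[k] _) = rightPiece k (V := V) i s := by
  rw [leftPiece_eq_span, rightPiece_eq_span, Submodule.map_span]
  congr 1
  ext x
  constructor
  · rintro ⟨_, ⟨j, p, hp, rfl⟩, rfl⟩
    exact ⟨j, p.reverse, by rw [length_reverse, hp], reversal_pathClass p⟩
  · rintro ⟨j, p, hp, rfl⟩
    refine ⟨_, ⟨j, p.reverse, by rw [length_reverse, hp], rfl⟩, ?_⟩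
    refine (reversal_pathClass _).trans ?_
    rw [Path.reverse_reverse]

variable {w : ∀ {h j : Symmetrify V}, (h ⟶ j) → k}
  {g : PreprojectiveAlgebra k V →ₗ[k] PreprojectiveAlgebra k V}

/-- A path and its reverse have weights with product `lam ^ s`, so `g` on one side is `lam ^ s`
times the inverse of `g` on the other. -/
theorem IsScaling.reversal_conj (hg : IsScaling w g) {lam : k}
    (hw : ∀ {h j : Symmetrify V} (a : h ⟶ j), w a * w (reverse a) = lam) {i : Symmetrify V} {s : ℕ}
    {x : PreprojectiveAlgebra k V} (hx : x ∈ leftPiece k (V := V) i s) :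
    g (reversal k V (g x)) = lam ^ s • reversal k V x := by
  rw [leftPiece_eq_span] at hx
  induction hx using Submodule.span_induction with
  | zero => simp
  | add u v _ _ hu hv => simp only [map_add, hu, hv, smul_add]
  | smul r u _ hu => simp only [map_smul, hu, smul_comm r]
  | mem x hx =>
    obtain ⟨j, p, rfl, rfl⟩ := hx
    rw [hg.map_pathClass, map_smul, map_smul, reversal_pathClass, hg.map_pathClass, smul_smul,
      pathWeight_reverse hw]

end Reversal

/-! ### Traces on `e_i A_s` and `A_s e_i` -/

section Pieces

variable {k : Type*} {V : Type*} [Field k] [Fintype V] [Quiver V] [∀ a b : V, Fintype (a ⟶ b)]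
  {w : ∀ {h j : Symmetrify V}, (h ⟶ j) → k}

theorem cell_le_rightPiece (i : Symmetrify V) (s : ℕ) (j : Symmetrify V) :
    cell k i s j ≤ rightPiece k (V := V) i s := by
  rw [rightPiece_eq_span]
  exact Submodule.span_mono fun x ⟨p, hp, hx⟩ => ⟨j, p, hp, hx⟩

theorem mul_idem_mem_cell {i : Symmetrify V} {s : ℕ} (j : Symmetrify V) {x : PreprojectiveAlgebra k V}
    (hx : x ∈ rightPiece k (V := V) i s) :
    x * pathClass k (Path.nil : Path j j) ∈ cell k i s j := by
  rw [rightPiece_eq_span] at hx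
  induction hx using Submodule.span_induction with
  | zero => simp
  | add u v _ _ hu hv => rw [add_mul]; exact add_mem hu hv
  | smul r u _ hu => rw [smul_mul_assoc]; exact Submodule.smul_mem _ _ hu
  | mem x hx =>
    obtain ⟨j', p, hp, rfl⟩ := hx
    by_cases h : j' = j
    · subst h
      rw [pathClass_mul, Path.comp_nil]
      exact pathClass_mem_cell p hp
    · rw [pathClass_mul_of_ne _ _ h]
      exact zero_mem _

theorem sum_mul_pathClass_nil (x : PreprojectiveAlgebra k V) :
    ∑ j : Symmetrify V, x * pathClass k (Path.nil : Path j j) = x := by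
  have h1 : ∑ j : Symmetrify V, pathClass k (Path.nil : Path j j) = 1 := by
    rw [← map_one (toPreprojective k V), PathAlgebra.one_def, map_sum]
    rfl
  rw [← Finset.mul_sum, h1, mul_one]

instance rightPiece_finite (i : Symmetrify V) (s : ℕ) : Module.Finite k (rightPiece k (V := V) i s) := by
  have hle : rightPiece k (V := V) i s ≤ ⨆ j : Symmetrify V, cell k i s j := by
    intro x hx
    rw [← sum_mul_pathClass_nil x]
    exact sum_mem fun j _ => Submodule.mem_iSup_of_mem j (mul_idem_mem_cell j hx)
  exact Submodule.finiteDimensional_of_le hle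

theorem trace_rightPiece {g : PreprojectiveAlgebra k V →ₗ[k] PreprojectiveAlgebra k V}
    (hg : IsScaling w g) (i : Symmetrify V) (s : ℕ) (f : rightPiece k (V := V) i s →ₗ[k] rightPiece k (V := V) i s)
    (hf : ∀ x, (f x : PreprojectiveAlgebra k V) = g x) :
    LinearMap.trace k (rightPiece k (V := V) i s) f = ∑ j, cellTrace hg i s j := by
  let π : ∀ j : Symmetrify V, rightPiece k (V := V) i s →ₗ[k] cell k i s j := fun j =>
    (LinearMap.mulRight k (pathClass k (Path.nil : Path j j))).restrict
      fun x hx => mul_idem_mem_cell j hx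
  let ι : ∀ j : Symmetrify V, cell k i s j →ₗ[k] rightPiece k (V := V) i s := fun j =>
    Submodule.inclusion (cell_le_rightPiece i s j)
  have hid : f = ∑ j, (f ∘ₗ ι j) ∘ₗ π j := by
    refine LinearMap.ext fun x => ?_
    rw [LinearMap.sum_apply]
    simp only [LinearMap.comp_apply, ← map_sum]
    congr 1
    apply Subtype.ext
    rw [Submodule.coe_sum]
    exact (sum_mul_pathClass_nil (x : PreprojectiveAlgebra k V)).symm
  conv_lhs => rw [hid]
  rw [map_sum]
  refine Finset.sum_congr rfl fun j _ => ?_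
  rw [LinearMap.trace_comp_comm', cellTrace]
  congr 1
  refine LinearMap.ext fun x => Subtype.ext ?_
  change (f (ι j x) : PreprojectiveAlgebra k V) * _ = g x
  rw [hf]
  exact mul_pathClass_nil_of_mem (hg.mapsTo_cell i s j x x.2)

theorem trace_restrictRight {g : PreprojectiveAlgebra k V ≃ₐ[k] PreprojectiveAlgebra k V}
    (hg : IsGradedAut g) {i : Symmetrify V} (hi : g (idem k (V := V) i) = idem k (V := V) i)
    (hw : IsScaling w (g.toLinearEquiv : _ →ₗ[k] _)) (s : ℕ) :
    LinearMap.trace k (rightPiece k (V := V) i s) (restrictRight hg hi s : _ →ₗ[k] _) =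
      ∑ j, cellTrace hw i s j :=
  trace_rightPiece hw i s _ fun _ => rfl

theorem trace_restrictLeft_symm {g : PreprojectiveAlgebra k V ≃ₐ[k] PreprojectiveAlgebra k V}
    (hg : IsGradedAut g) {i : Symmetrify V} (hi : g (idem k (V := V) i) = idem k (V := V) i)
    (hw : IsScaling w (g.toLinearEquiv : _ →ₗ[k] _)) {lam : k} (hlam : lam ≠ 0)
    (hrev : ∀ {h j : Symmetrify V} (a : h ⟶ j), w a * w (reverse a) = lam) (s : ℕ) :
    LinearMap.trace k (leftPiece k (V := V) i s) ((restrictLeft hg hi s).symm : _ →ₗ[k] _) =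
      (lam⁻¹) ^ s * LinearMap.trace k (rightPiece k (V := V) i s) (restrictRight hg hi s : _ →ₗ[k] _) := by
  let e : leftPiece k (V := V) i s ≃ₗ[k] rightPiece k (V := V) i s :=
    (reversal k V).ofSubmodules _ _ (map_reversal_leftPiece i s)
  rw [← LinearMap.trace_conj' _ e, ← smul_eq_mul, ← map_smul]
  congr 1
  refine LinearMap.ext fun x => ?_
  obtain ⟨y, rfl⟩ := e.surjective x
  obtain ⟨z, rfl⟩ := (restrictLeft hg hi s).surjective y
  rw [LinearEquiv.conj_apply_apply, LinearEquiv.symm_apply_apply, LinearEquiv.coe_coe,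
    LinearEquiv.symm_apply_apply]
  apply Subtype.ext
  have h1 : g (reversal k V (g z)) = lam ^ s • reversal k V (z : PreprojectiveAlgebra k V) :=
    hw.reversal_conj hrev z.2
  change reversal k V (z : PreprojectiveAlgebra k V) = (lam⁻¹) ^ s • g (reversal k V (g z))
  rw [h1, smul_smul, ← mul_pow, inv_mul_cancel₀ hlam, one_pow, one_smul]

end Pieces

/-! ### From the recurrence to rational functions -/

section Rational

variable {k : Type*} [Field k]

variable (k) in
/-- The substitution `t ↦ t⁻¹` as a ring homomorphism. -/
def invVarHom : RatFunc k →+* RatFunc k :=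
  RatFunc.liftRingHom (Polynomial.eval₂RingHom RatFunc.C (RatFunc.X)⁻¹) (by
    -- Transcendence of `t⁻¹` ensures that no nonzero denominator becomes zero under the
    -- substitution.
    have htr : Transcendental k (RatFunc.X : RatFunc k)⁻¹ := by
      intro h
      have := IsAlgebraic.inv h
      rw [inv_inv] at this
      exact RatFunc.transcendental_X this
    refine nonZeroDivisors_le_comap_nonZeroDivisors_of_injective _ ?_
    exact transcendental_iff_injective.1 htr)

theorem invVarHom_apply (F : RatFunc k) : invVarHom k F = invVar F := by
  rw [invVarHom, RatFunc.liftRingHom_apply]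
  rfl

theorem invVarHom_C (r : k) : invVarHom k (RatFunc.C r) = RatFunc.C r := by
  rw [invVarHom_apply, invVar, RatFunc.eval_C]

theorem invVarHom_X : invVarHom k RatFunc.X = (RatFunc.X)⁻¹ := by
  rw [invVarHom_apply, invVar, RatFunc.eval_X]

variable {I : Type*} [Fintype I] [DecidableEq I]

/-- The matrix `1 - t C + λ t²`. -/
def quadMatrix (C : Matrix I I k) (lam : k) : Matrix I I (RatFunc k) :=
  1 - (RatFunc.X : RatFunc k) • C.map RatFunc.C + (RatFunc.C lam * RatFunc.X ^ 2) • 1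

/-- The determinant is a polynomial in `t` with value 1 at `t = 0`. -/
theorem isUnit_det_quadMatrix (C : Matrix I I k) (lam : k) : IsUnit (quadMatrix C lam).det := by
  let B : Matrix I I (Polynomial k) :=
    1 - (Polynomial.X : Polynomial k) • C.map Polynomial.C +
      (Polynomial.C lam * Polynomial.X ^ 2) • 1
  have hB : quadMatrix C lam = (algebraMap (Polynomial k) (RatFunc k)).mapMatrix B := by
    ext a b
    by_cases h : a = b
    · subst h
      simp [quadMatrix, B, mul_comm RatFunc.X]
    · simp [quadMatrix, B, Matrix.one_apply_ne h, mul_comm RatFunc.X]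
  have h0 : (Polynomial.evalRingHom (0 : k)).mapMatrix B = 1 := by
    ext a b
    by_cases h : a = b
    · subst h
      simp [B]
    · simp [B, Matrix.one_apply_ne h]
  have hdet : B.det ≠ 0 := by
    intro h
    have := congrArg (Polynomial.evalRingHom (0 : k)) h
    rw [RingHom.map_det, h0, Matrix.det_one, map_zero] at this
    exact one_ne_zero this
  rw [hB, ← RingHom.map_det, isUnit_iff_ne_zero]
  exact (map_ne_zero_iff _ (RatFunc.algebraMap_injective k)).2 hdet

theorem mapMatrix_inv {K L : Type*} [Field K] [Field L] (f : K →+* L) (M : Matrix I I K)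
    (hM : IsUnit M.det) : f.mapMatrix M⁻¹ = (f.mapMatrix M)⁻¹ := by
  symm
  apply Matrix.inv_eq_right_inv
  rw [← map_mul, Matrix.mul_nonsing_inv _ hM, map_one]

open scoped RatFunc in
variable (k) in
/-- The embedding of the rational functions into the Laurent series. -/
def toLaurent : RatFunc k →+* LaurentSeries k := algebraMap _ _

theorem toLaurent_X :
    toLaurent k RatFunc.X = HahnSeries.ofPowerSeries ℤ k PowerSeries.X := by
  rw [HahnSeries.ofPowerSeries_X]
  exact RatFunc.coe_X

theorem toLaurent_C (r : k) :
    toLaurent k (RatFunc.C r) = HahnSeries.ofPowerSeries ℤ k (PowerSeries.C r) := by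
  have := RatFunc.coe_coe (Polynomial.C r)
  rw [Polynomial.coe_C, RatFunc.coePolynomial_eq_algebraMap, RatFunc.algebraMap_C] at this
  exact this.symm

/-- The recurrence and its initial values say that the row vector `u = ∑ v_s t^s` satisfies `u (1 -
tC + λt²) = e_i`. The matrix can be inverted over Laurent series, where both kinds of functions
live. -/
theorem hasExpansion_sum_inv_quadMatrix (C : Matrix I I k) (lam : k) (i : I) (v : ℕ → I → k)
    (h0 : v 0 = Pi.single i 1) (h1 : ∀ j, v 1 j = ∑ h, v 0 h * C h j)
    (h2 : ∀ s j, v (s + 2) j = ∑ h, v (s + 1) h * C h j - lam * v s j) :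
    HasExpansion (∑ j, (quadMatrix C lam)⁻¹ i j) (PowerSeries.mk fun s => ∑ j, v s j) := by
  let u : I → PowerSeries k := fun j => PowerSeries.mk fun s => v s j
  have hu : ∀ j, u j - PowerSeries.X * ∑ h, u h * PowerSeries.C (C h j) +
      PowerSeries.C lam * PowerSeries.X ^ 2 * u j = (Pi.single i 1 : I → PowerSeries k) j := by
    intro j
    have hR : (Pi.single i 1 : I → PowerSeries k) j = PowerSeries.C ((Pi.single i 1 : I → k) j) := by
      by_cases h : j = i
      · subst h; simp
      · simp [h]
    rw [hR, ← h0]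
    ext n
    rw [mul_assoc]
    rcases n with _ | _ | n
    · simp [u]
    · simp [u, pow_two, mul_assoc, PowerSeries.coeff_succ_X_mul, h1]
    · simp [u, pow_two, mul_assoc, PowerSeries.coeff_succ_X_mul, h2]
  let up : I → LaurentSeries k := fun j => HahnSeries.ofPowerSeries ℤ k (u j)
  let N : Matrix I I (PowerSeries k) :=
    1 - (PowerSeries.X : PowerSeries k) • C.map PowerSeries.C +
      (PowerSeries.C lam * PowerSeries.X ^ 2) • 1
  have hN : (toLaurent k).mapMatrix (quadMatrix C lam) =
      (HahnSeries.ofPowerSeries ℤ k).mapMatrix N := by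
    ext1 a b
    by_cases h : a = b
    · subst h
      simp only [quadMatrix, N, RingHom.mapMatrix_apply, Matrix.map_apply, Matrix.add_apply,
        Matrix.sub_apply, Matrix.smul_apply, Matrix.one_apply_eq, smul_eq_mul, map_add, map_sub,
        map_mul, map_one, map_pow, toLaurent_X, toLaurent_C]
    · simp only [quadMatrix, N, RingHom.mapMatrix_apply, Matrix.map_apply, Matrix.add_apply,
        Matrix.sub_apply, Matrix.smul_apply, Matrix.one_apply_ne h, smul_eq_mul, map_add, map_sub,
        map_mul, map_zero, mul_zero, toLaurent_X, toLaurent_C]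
  have hM : Matrix.vecMul up ((toLaurent k).mapMatrix (quadMatrix C lam)) = Pi.single i 1 := by
    funext j
    have h3 : ∑ h, u h * N h j = (Pi.single i 1 : I → PowerSeries k) j := by
      rw [← hu j]
      simp only [N, Matrix.add_apply, Matrix.sub_apply, Matrix.smul_apply, Matrix.map_apply,
        Matrix.one_apply, smul_eq_mul, mul_add, mul_sub, Finset.sum_add_distrib,
        Finset.sum_sub_distrib, mul_ite, mul_one, mul_zero, Finset.sum_ite_eq', Finset.mem_univ,
        if_true, Finset.mul_sum]
      congr 1
      · congr 1
        exact Finset.sum_congr rfl fun h _ => by ring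
      · ring
    have h4 := congrArg (HahnSeries.ofPowerSeries ℤ k) h3
    rw [map_sum] at h4
    simp only [map_mul] at h4
    rw [hN]
    refine h4.trans ?_
    by_cases h : j = i
    · subst h; simp
    · simp [h]
  have hinv : up = (toLaurent k).mapMatrix (quadMatrix C lam)⁻¹ i := by
    have hun : IsUnit ((toLaurent k).mapMatrix (quadMatrix C lam)).det := by
      rw [← RingHom.map_det]
      exact (isUnit_det_quadMatrix C lam).map (toLaurent k)
    rw [mapMatrix_inv _ _ (isUnit_det_quadMatrix C lam)]
    have := congrArg (fun x => Matrix.vecMul x ((toLaurent k).mapMatrix (quadMatrix C lam))⁻¹) hM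
    simpa only [Matrix.vecMul_vecMul, Matrix.mul_nonsing_inv _ hun, Matrix.vecMul_one,
      Matrix.single_one_vecMul, Matrix.row] using this
  have hsum : (PowerSeries.mk fun s => ∑ j, v s j) = ∑ j, u j := by
    ext n
    simp [u]
  rw [HasExpansion, hsum]
  change toLaurent k _ = HahnSeries.ofPowerSeries ℤ k _
  rw [map_sum, map_sum]
  refine Finset.sum_congr rfl fun j _ => ?_
  exact (congrFun hinv j).symm

theorem exists_ratFunc_of_recurrence (C : Matrix I I k) {lam : k} (hlam : lam ≠ 0) (i : I)
    (v : ℕ → I → k)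
    (h0 : v 0 = Pi.single i 1) (h1 : ∀ j, v 1 j = ∑ h, v 0 h * C h j)
    (h2 : ∀ s j, v (s + 2) j = ∑ h, v (s + 1) h * C h j - lam * v s j) :
    ∃ F G : RatFunc k, HasExpansion F (PowerSeries.mk fun s => ∑ j, v s j) ∧
      HasExpansion G (PowerSeries.mk fun s => (lam⁻¹) ^ s * ∑ j, v s j) ∧
      invVar G = RatFunc.C lam * RatFunc.X ^ 2 * F := by
  refine ⟨_, ∑ j, (quadMatrix (lam⁻¹ • C) lam⁻¹)⁻¹ i j, hasExpansion_sum_inv_quadMatrix C lam i v h0 h1 h2, ?_, ?_⟩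
  · have := hasExpansion_sum_inv_quadMatrix (lam⁻¹ • C) lam⁻¹ i (fun s j => (lam⁻¹) ^ s * v s j)
      (by funext j; simp [h0])
      (by
        intro j
        rw [h1, Finset.mul_sum]
        refine Finset.sum_congr rfl fun h _ => ?_
        simp only [Matrix.smul_apply, smul_eq_mul]
        ring)
      (by
        intro s j
        rw [h2, mul_sub, Finset.mul_sum]
        congr 1
        · refine Finset.sum_congr rfl fun h _ => ?_
          simp only [Matrix.smul_apply, smul_eq_mul]
          ring
        · linear_combination (lam⁻¹) ^ (s + 1) * v s j * inv_mul_cancel₀ hlam)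
    simpa only [Finset.mul_sum] using this
  · have hX : (RatFunc.X : RatFunc k) ≠ 0 := RatFunc.X_ne_zero
    have hC : (RatFunc.C lam : RatFunc k) ≠ 0 := by simpa using hlam
    -- The functional equation at the level of matrices: `1 - λ⁻¹t⁻¹C + λ⁻¹t⁻² = (λt²)⁻¹ (1 - tC +
    -- λt²)`.
    have hM : (invVarHom k).mapMatrix (quadMatrix (lam⁻¹ • C) lam⁻¹) =
        (RatFunc.C lam * RatFunc.X ^ 2 : RatFunc k)⁻¹ • quadMatrix C lam := by
      ext a b
      by_cases hab : a = b
      · subst hab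
        simp [quadMatrix, invVarHom_C, invVarHom_X, -RatFunc.algebraMap_eq_C]
        field_simp
        ring
      · simp [quadMatrix, invVarHom_C, invVarHom_X, Matrix.one_apply_ne hab]
        field_simp
    rw [← invVarHom_apply, map_sum, Finset.mul_sum]
    refine Finset.sum_congr rfl fun j _ => ?_
    have h3 := congrFun (congrFun (mapMatrix_inv (invVarHom k) _
      (isUnit_det_quadMatrix (lam⁻¹ • C) lam⁻¹)) i) j
    have h4 : ((RatFunc.C lam * RatFunc.X ^ 2 : RatFunc k)⁻¹ • quadMatrix C lam)⁻¹ =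
        (RatFunc.C lam * RatFunc.X ^ 2 : RatFunc k) • (quadMatrix C lam)⁻¹ := by
      apply Matrix.inv_eq_left_inv
      rw [Matrix.smul_mul, Matrix.mul_smul, smul_smul, mul_inv_cancel₀ (mul_ne_zero hC (pow_ne_zero 2 hX)), one_smul,
        Matrix.nonsing_inv_mul _ (isUnit_det_quadMatrix C lam)]
    rw [hM, h4] at h3
    exact h3

end Rational

/-! ### The imaginary root and connectedness of extended Dynkin graphs -/

section ExtendedDynkin

/-- The minimal positive imaginary root of an extended Dynkin graph. -/
def ExtendedDynkinType.root : ExtendedDynkinType → ℕ → ℕ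
  | A _ => fun _ => 1
  | D m => fun v => if 2 ≤ v ∧ v < m + 3 then 2 else 1
  -- The entries follow the vertex numbering used in `edges`; the default 1 is taken only outside
  -- the range of vertices.
  | E6 => fun v => [1, 2, 3, 2, 1, 2, 1].getD v 1
  | E7 => fun v => [1, 2, 3, 4, 3, 2, 1, 2].getD v 1
  | E8 => fun v => [1, 2, 3, 4, 5, 6, 4, 2, 3].getD v 1

theorem ExtendedDynkinType.root_pos (T : ExtendedDynkinType) {v : ℕ} (hv : v < T.order) :
    0 < T.root v := by
  cases T with
  | A m => exact Nat.one_pos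
  | D m => simp only [root]; split_ifs <;> omega
  | E6 => simp only [order] at hv; interval_cases v <;> decide
  | E7 => simp only [order] at hv; interval_cases v <;> decide
  | E8 => simp only [order] at hv; interval_cases v <;> decide

theorem sum_map_range_ite (m d v : ℕ) (f : ℕ → ℕ) :
    ((List.range m).map fun i => if i + d = v then f i else 0).sum =
      if d ≤ v ∧ v < m + d then f (v - d) else 0 := by
  induction m with
  | zero => simp
  | succ m ih =>
    rw [List.range_succ, List.map_append, List.sum_append, ih]
    simp only [List.map_cons, List.map_nil, List.sum_cons, List.sum_nil]
    by_cases h : m + d = v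
    · subst h
      simp
    · rw [if_neg h]
      simp only [add_zero]
      congr 1
      apply propext
      omega

/-- Each edge is tested at both of its ends, so parallel edges count with multiplicity and the
orientation in the list is irrelevant. -/
theorem ExtendedDynkinType.sum_root (T : ExtendedDynkinType) {v : ℕ} (hv : v < T.order) :
    (T.edges.map fun e => (if e.1 = v then T.root e.2 else 0) +
      (if e.2 = v then T.root e.1 else 0)).sum = 2 * T.root v := by
  cases T with
  | A m =>
    have h1 := sum_map_range_ite (m + 1) 0 v (fun _ => 1)
    have h2 := sum_map_range_ite (m + 1) 1 v (fun _ => 1)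
    simp only [order] at hv
    simp only [edges, root, List.map_append, List.map_map, List.sum_append, Function.comp_def,
      List.map_cons, List.map_nil, List.sum_cons, List.sum_nil, List.sum_map_add] at h1 h2 ⊢
    simp only [add_zero] at h1
    rw [h1, h2]
    split_ifs <;> omega
  | D m =>
    obtain ⟨r, hr⟩ : ∃ r, r = root (D m) := ⟨_, rfl⟩
    have hr' : ∀ u, r u = if 2 ≤ u ∧ u < m + 3 then 2 else 1 := fun u => congrFun hr u
    have h1 := sum_map_range_ite m 2 v (fun i => r (i + 3))
    have h2 := sum_map_range_ite m 3 v (fun i => r (i + 2))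
    rw [← hr]
    simp only [order] at hv
    simp only [edges, List.map_append, List.map_map, List.sum_append, Function.comp_def,
      List.map_cons, List.map_nil, List.sum_cons, List.sum_nil, List.sum_map_add]
    rw [h1, h2]
    clear h1 h2 hr
    rcases Nat.lt_or_ge v 2 with h | h
    · grind
    · grind
  | E6 => simp only [order] at hv; interval_cases v <;> decide
  | E7 => simp only [order] at hv; interval_cases v <;> decide
  | E8 => simp only [order] at hv; interval_cases v <;> decide

/-- Connectedness, phrased as constancy of functions that agree along edges. -/
theorem ExtendedDynkinType.eq_zero_of_edges (T : ExtendedDynkinType) {S : Type*} (f : ℕ → S)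
    (hf : ∀ e ∈ T.edges, f e.1 = f e.2) {v : ℕ} (hv : v < T.order) : f v = f 0 := by
  cases T with
  | A m =>
    simp only [order] at hv
    induction v with
    | zero => rfl
    | succ v ih =>
      rw [← ih (by omega)]
      refine (hf (v, v + 1) ?_).symm
      simp only [edges, List.mem_append, List.mem_map, List.mem_range]
      exact Or.inl ⟨v, by omega, rfl⟩
  | D m =>
    simp only [order] at hv
    simp only [edges, List.mem_append, List.mem_map, List.mem_range, List.mem_cons,
      List.not_mem_nil, or_false] at hf
    have h02 : f 0 = f 2 := hf (0, 2) (by simp)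
    have h12 : f 1 = f 2 := hf (1, 2) (by simp)
    have hchain : ∀ j ≤ m, f (j + 2) = f 2 := by
      intro j
      induction j with
      | zero => intro _; rfl
      | succ j ih =>
        intro hj
        rw [← ih (by omega)]
        exact (hf (j + 2, j + 3) (Or.inl (Or.inr ⟨j, by omega, rfl⟩))).symm
    have h3 : f (m + 2) = f (m + 3) := hf (m + 2, m + 3) (by simp)
    have h4 : f (m + 2) = f (m + 4) := hf (m + 2, m + 4) (by simp)
    have hm := hchain m le_rfl
    obtain rfl | rfl | hv2 | rfl | rfl : v = 0 ∨ v = 1 ∨ (2 ≤ v ∧ v ≤ m + 2) ∨ v = m + 3 ∨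
      v = m + 4 := by omega
    · rfl
    · rw [h12, h02]
    · have := hchain (v - 2) (by omega)
      rw [Nat.sub_add_cancel hv2.1] at this
      rw [this, h02]
    · rw [← h3, hm, h02]
    · rw [← h4, hm, h02]
  | E6 =>
    simp only [edges, List.forall_mem_cons] at hf
    simp only [order] at hv
    interval_cases v <;> grind
  | E7 =>
    simp only [edges, List.forall_mem_cons] at hf
    simp only [order] at hv
    interval_cases v <;> grind
  | E8 =>
    simp only [edges, List.forall_mem_cons] at hf
    simp only [order] at hv
    interval_cases v <;> grind

variable {V : Type*} [Fintype V] [Quiver V] [∀ a b : V, Fintype (a ⟶ b)]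

theorem IsExtendedDynkin.exists_root (hV : IsExtendedDynkin V) :
    ∃ δ : V → ℕ, (∀ j, 0 < δ j) ∧
      ∀ h : V, ∑ j, ((∑ _α : h ⟶ j, δ j) + ∑ _α : j ⟶ h, δ j) = 2 * δ h := by
  classical
  obtain ⟨T, φ, σ, hσ⟩ := hV
  let δ : V → ℕ := fun j => T.root (φ j)
  refine ⟨δ, fun j => T.root_pos (φ j).2, fun h => ?_⟩
  have hinj : ∀ a b : V, a = b ↔ (φ a : ℕ) = φ b := fun a b => by
    rw [← Fin.ext_iff, φ.injective.eq_iff]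
  have h2 : (∑ x : Σ a b : V, (a ⟶ b), ((if x.1 = h then δ x.2.1 else 0) +
      (if x.2.1 = h then δ x.1 else 0))) = 2 * δ h := by
    refine Eq.trans ?_ (T.sum_root (φ h).2)
    rw [← Fin.sum_univ_fun_getElem, ← σ.sum_comp]
    refine Finset.sum_congr rfl fun x _ => ?_
    obtain ⟨a, b, α⟩ := x
    have := hσ a b α
    rw [Sym2.eq_iff] at this
    simp only [List.get_eq_getElem] at this
    simp only [hinj, δ]
    rcases this with ⟨ha, hb⟩ | ⟨ha, hb⟩
    · simp only [← ha, ← hb]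
    · simp only [← ha, ← hb]
      exact add_comm _ _
  rw [← h2]
  simp only [Fintype.sum_sigma, Finset.sum_add_distrib]
  congr 1
  · rw [Finset.sum_eq_single (a := h) (s := Finset.univ) (f := fun a => ∑ b, ∑ _α : a ⟶ b, _)]
    · simp
    · intro a _ ha
      simp [ha]
    · simp
  · refine Finset.sum_congr rfl fun a _ => ?_
    rw [Finset.sum_eq_single h]
    · simp
    · intro b _ hb
      simp [hb]
    · simp

theorem IsExtendedDynkin.exists_root_symmetrify (hV : IsExtendedDynkin V) :
    ∃ δ : Symmetrify V → ℕ, (∀ j, 0 < δ j) ∧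
      ∀ h : Symmetrify V, ∑ j, ∑ _a : h ⟶ j, δ j = 2 * δ h := by
  obtain ⟨δ, hpos, hδ⟩ := hV.exists_root
  refine ⟨δ, hpos, fun h => Eq.trans ?_ (hδ h)⟩
  exact Finset.sum_congr rfl fun j _ =>
    Fintype.sum_sum_type (α₁ := (show V from h) ⟶ (show V from j))
      (α₂ := (show V from j) ⟶ (show V from h)) _

omit [Fintype V] [∀ a b : V, Fintype (a ⟶ b)] in
theorem IsExtendedDynkin.eq_of_arrows (hV : IsExtendedDynkin V) {S : Type*}
    (F : Symmetrify V → S)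
    (hF : ∀ {h j : Symmetrify V} (_ : h ⟶ j), F h = F j) (h j : Symmetrify V) : F h = F j := by
  obtain ⟨T, φ, σ, hσ⟩ := hV
  let F' : V → S := F
  -- The value `F h` past the last vertex is arbitrary: ends of edges always have the form `φ a`.
  let f : ℕ → S := fun n => if hn : n < T.order then F' (φ.symm ⟨n, hn⟩) else F h
  have hf : ∀ a : V, f (φ a) = F' a := by
    intro a
    simp [f]
  have key : ∀ a : V, F' a = f 0 := by
    intro a
    rw [← hf a]
    refine T.eq_zero_of_edges f ?_ (φ a).2
    intro e he
    obtain ⟨n, rfl⟩ := List.get_of_mem he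
    obtain ⟨⟨a, b, α⟩, rfl⟩ := σ.surjective n
    have hab : F' a = F' b := hF (Hom.toPos α)
    have := hσ a b α
    rw [Sym2.eq_iff] at this
    rcases this with ⟨ha, hb⟩ | ⟨ha, hb⟩
    · rw [← ha, ← hb, hf, hf, hab]
    · rw [← ha, ← hb, hf, hf, hab]
  exact (key h).trans (key j).symm

end ExtendedDynkin

/-! ### The functional equation for a scaling map -/

section Scaling

variable {k : Type*} {V : Type*} [Field k] [Fintype V] [Quiver V] [∀ a b : V, Fintype (a ⟶ b)]
  {w : ∀ {h j : Symmetrify V}, (h ⟶ j) → k}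
  {g : PreprojectiveAlgebra k V →ₗ[k] PreprojectiveAlgebra k V}

theorem IsScaling.exists_ratFunc (hw : IsScaling w g) {lam : k} (hlam : lam ≠ 0)
    (hrev : ∀ {h j : Symmetrify V} (a : h ⟶ j), w a * w (reverse a) = lam) (i : Symmetrify V)
    (hinj : ∀ s j, Function.Injective (spread k i s j)) :
    ∃ F G : RatFunc k, HasExpansion F (PowerSeries.mk fun s => ∑ j, cellTrace hw i s j) ∧
      HasExpansion G (PowerSeries.mk fun s => (lam⁻¹) ^ s * ∑ j, cellTrace hw i s j) ∧
      invVar G = RatFunc.C lam * RatFunc.X ^ 2 * F := by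
  classical
  let C : Matrix (Symmetrify V) (Symmetrify V) k := fun h j => ∑ a : h ⟶ j, w a
  have hC : ∀ (v : Symmetrify V → k) (j : Symmetrify V),
      ∑ h, ∑ a : h ⟶ j, w a * v h = ∑ h, v h * C h j := by
    intro v j
    refine Finset.sum_congr rfl fun h _ => ?_
    rw [← Finset.sum_mul, mul_comm]
  refine exists_ratFunc_of_recurrence C hlam i (fun s j => cellTrace hw i s j) ?_ ?_ ?_
  · funext j
    by_cases hj : i = j
    · subst hj
      rw [Pi.single_eq_same, cellTrace_zero_self]
    · rw [Pi.single_eq_of_ne (Ne.symm hj), cellTrace_zero_of_ne hw hj]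
  · exact fun j => (cellTrace_one hw i j).trans (hC _ j)
  · intro s j
    rw [cellTrace_add_two hw hrev i s j (hinj s j), hC]

end Scaling

end Preproj

end

/-! ### The theorem -/

open Preproj Quiver in
theorem proposition5p1 {k : Type*} [Field k] [IsAlgClosed k] [CharZero k]
    {V : Type*} [Fintype V] [Quiver V] [∀ a b : V, Fintype (a ⟶ b)]
    (hV : Preproj.IsExtendedDynkin V)
    (c t : ∀ {a b : V}, (a ⟶ b) → k)
    (hc : ∀ {a b : V} (α : a ⟶ b), c α ≠ 0) (ht : ∀ {a b : V} (α : a ⟶ b), t α ≠ 0)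
    (g : Preproj.PreprojectiveAlgebra k V ≃ₐ[k] Preproj.PreprojectiveAlgebra k V)
    (hg : Preproj.IsGradedAut g)
    (hidem : ∀ i : V, g (Preproj.idem k i) = Preproj.idem k i)
    (harrow : ∀ {a b : V} (α : a ⟶ b), g (Preproj.arrow k α) = c α • Preproj.arrow k α)
    (hdual : ∀ {a b : V} (α : a ⟶ b), g (Preproj.arrowDual k α) = t α • Preproj.arrowDual k α)
    (i : V) :
    ∃ F G : RatFunc k,
      Preproj.HasExpansion F
        (Preproj.traceSeries (Preproj.restrictRight hg (hidem i))) ∧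
      Preproj.HasExpansion G
        (Preproj.traceSeries fun s => (Preproj.restrictLeft hg (hidem i) s).symm) ∧
      ∀ {a b : V} (α : a ⟶ b),
        Preproj.invVar G = RatFunc.C (c α * t α) * RatFunc.X ^ 2 * F := by
  classical
  let w : ∀ {h j : Symmetrify V}, (h ⟶ j) → k := fun {h j} a =>
    Sum.elim (fun α : (show V from h) ⟶ (show V from j) => c α)
      (fun α : (show V from j) ⟶ (show V from h) => t α) a
  have hw0 : ∀ {h j : Symmetrify V} (a : h ⟶ j), w a ≠ 0 := by
    intro h j a
    rcases a with a | a
    · exact hc a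
    · exact ht a
  have hw : IsScaling w (g.toLinearEquiv : _ →ₗ[k] _) := by
    refine ⟨hidem, fun x {h j} a => ?_⟩
    have ha : g (arrowClass k a) = w a • arrowClass k a := by
      rcases a with a | a
      · exact harrow a
      · exact hdual a
    change g (x * arrowClass k a) = w a • (g x * arrowClass k a)
    rw [map_mul, ha, mul_smul_comm]
  obtain ⟨lam, hlam, hrev⟩ := hw.exists_forall_mul_reverse_eq hw0
    fun f hf => hV.eq_of_arrows f hf
  obtain ⟨δ, hpos, hδ⟩ := hV.exists_root_symmetrify
  obtain ⟨F, G, hF, hG, hFG⟩ := hw.exists_ratFunc hlam hrev i (spread_injective δ hpos hδ i)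
  have hright : traceSeries (restrictRight hg (hidem i)) =
      PowerSeries.mk fun s => ∑ j, cellTrace hw i s j := by
    ext s
    rw [traceSeries, PowerSeries.coeff_mk, PowerSeries.coeff_mk]
    exact trace_restrictRight hg (hidem i) hw s
  have hleft : (traceSeries fun s => (restrictLeft hg (hidem i) s).symm) =
      PowerSeries.mk fun s => (lam⁻¹) ^ s * ∑ j, cellTrace hw i s j := by
    ext s
    rw [traceSeries, PowerSeries.coeff_mk, PowerSeries.coeff_mk]
    refine (trace_restrictLeft_symm hg (hidem i) hw hlam hrev s).trans ?_
    congr 1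
    exact trace_restrictRight hg (hidem i) hw s
  refine ⟨F, G, hright ▸ hF, hleft ▸ hG, fun {a b} α => ?_⟩
  -- In the double, `α` has weight `c α` and its reverse `α*` has weight `t α`.
  have hα : c α * t α = lam := @hrev a b (Sum.inl α)
  rw [hα, hFG]
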